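/- Let $k$ be a field of characteristic zero, and let $e_1,\dots,e_7$ be the standard basis of $W=k^7$ (column vectors). Put $e_{ijl}=e_i\wedge e_j\wedge e_l$ and $$\bar w=e_{234}+e_{567}+e_{125}+e_{136}+e_{147}\in\wedge^3W .$$ Let $G\subset \mathrm{GL}(7)$ be the algebraic group over $k$ of all $g$ with $g\bar w=c(g)\bar w$ for some $c(g)\in \mathrm{GL}(1)$ (for the natural action on $\wedge^3W$). Let $w=e_1\in W$, let $G_w$ be the stabilizer of $w$ in $G$, and let $G_w^0$ be its identity component. For $A\in \mathrm{SL}(3)$ and $\Lambda=\mathrm{diag}(1,1,-1)$ put $$d(A)=\begin{pmatrix}1&0&0\\0&A&0\\0&0&{}^tA^{-1}\end{pmatrix},\qquad \tau=\begin{pmatrix}1&0&0\\0&0&\Lambda\\0&\Lambda&0\end{pmatrix}$$ (blocks of sizes $1,3,3$). Then, as algebraic groups over $k$ (that is, for points in all commutative $k$-algebras $R$, functorially in $R$): 1. $A\mapsto d(A)$ is an isomorphism of $\mathrm{SL}(3)$ onto $G_w^0$. 2. $\tau$ is an element of order $2$ of $G_w$, and $G_w$ is generated by $G_w^0$ and $\tau$: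 for every commutative $k$-algebra $R$ with connected spectrum (in particular for every extension field of $k$), the group $G_w(R)$ is generated by $G_w^0(R)$ and $\tau$. 3. There is a split exact sequence of algebraic groups over $k$ $$1\longrightarrow \mathrm{SL}(3)\xrightarrow{\ d\ }G_w\xrightarrow{\ \pi\ }\mathbb Z/2\mathbb Z\longrightarrow 1,$$ with $\mathbb Z/2\mathbb Z$ the constant group scheme, in which $\tau$ maps to the nontrivial element of $\mathbb Z/2\mathbb Z$, and which is split by the homomorphism sending the nontrivial element to $\tau$. That is, for every commutative $k$-algebra $R$, functorially in $R$, the kernel of $\pi$ on $G_w(R)$ is $d(\mathrm{SL}(3)(R))$ and $\pi$ has a section. -/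

import Mathlib

universe u

noncomputable section

namespace PrehomG2

open Matrix

/-- A linear algebraic group over `k` inside `GL(n)`, given by its functor of points on
commutative `k`-algebras: a subgroup of `GL(n, R)` for every `R`, compatible with base change. -/
structure LinearGroup (k : Type u) [Field k] (n : ℕ) where
  /-- the group of `R`-valued points -/
  points : ∀ (R : Type u) [CommRing R] [Algebra k R], Subgroup (GL (Fin n) R)
  map_mem : ∀ {R S : Type u} [CommRing R] [Algebra k R] [CommRing S] [Algebra k S]
    (f : R →ₐ[k] S) (g : GL (Fin n) R), g ∈ points R →
      GeneralLinearGroup.map (f : R →+* S) g ∈ points S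

namespace LinearGroup

variable {k : Type u} [Field k] {n : ℕ}

/-- The homomorphism `H(R) → H(S)` induced by a `k`-algebra homomorphism `R → S`. -/
def map (H : LinearGroup k n) {R S : Type u} [CommRing R] [Algebra k R] [CommRing S]
    [Algebra k S] (f : R →ₐ[k] S) : H.points R →* H.points S :=
  ((GeneralLinearGroup.map (f : R →+* S)).comp (H.points R).subtype).codRestrict (H.points S)
    fun g => H.map_mem f g.1 g.2

/-- The `k`-algebra homomorphism `k[x_ij] → R` that sends `x_ij` to the `(i, j)` entry of `g`.
On spectra it is the composite of `g : Spec R → GL(n)` with the open immersion of `GL(n)` into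
the affine space of `n × n` matrices. -/
def evalAt (k : Type u) [Field k] {n : ℕ} {R : Type u} [CommRing R] [Algebra k R]
    (g : GL (Fin n) R) : MvPolynomial (Fin n × Fin n) k →ₐ[k] R :=
  MvPolynomial.aeval fun ij => g.1 ij.1 ij.2

/-- The underlying set of the scheme `H`, as a subset of `Spec k[x_ij]`: a point of `H` is the
image of some field-valued point of `H`. The topology of the scheme `H` is the subspace
(Zariski) topology. -/
def carrier (H : LinearGroup k n) : Set (PrimeSpectrum (MvPolynomial (Fin n × Fin n) k)) :=
  {p | ∃ (K : Type u) (_ : Field K) (_ : Algebra k K), ∃ g ∈ H.points K,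
    p.asIdeal = RingHom.ker (evalAt k g)}

/-- The point of `Spec k[x_ij]` given by the identity matrix. -/
def identityPoint (k : Type u) [Field k] (n : ℕ) :
    PrimeSpectrum (MvPolynomial (Fin n × Fin n) k) :=
  ⟨RingHom.ker (evalAt k (1 : GL (Fin n) k)), RingHom.ker_isPrime _⟩

/-- The `R`-valued points of the identity component `H⁰`: the points `g : Spec R → H` whose image
lies in the Zariski-connected component of the identity in `H`. -/
def identityComponent (H : LinearGroup k n) (R : Type u) [CommRing R] [Algebra k R] :
    Set (GL (Fin n) R) :=
  {g | g ∈ H.points R ∧ ∀ p : PrimeSpectrum R,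
    PrimeSpectrum.comap (evalAt k g : MvPolynomial (Fin n × Fin n) k →+* R) p ∈
      connectedComponentIn H.carrier (identityPoint k n)}

end LinearGroup

section Trivector

variable (R : Type u) [CommRing R]

/-- The standard basis vectors of `R⁷`; `stdVec R i` is `e_{i+1}`. -/
def stdVec (i : Fin 7) : Fin 7 → R := Pi.single i 1

/-- `wedge3 R i j l` is `e_{i+1} ∧ e_{j+1} ∧ e_{l+1}`. -/
def wedge3 (i j l : Fin 7) : ⋀[R]^3 (Fin 7 → R) :=
  exteriorPower.ιMulti R 3 ![stdVec R i, stdVec R j, stdVec R l]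

/-- The trivector `e₂₃₄ + e₅₆₇ + e₁ ∧ (e₂₅ + e₃₆ + e₄₇)`. -/
def wBar : ⋀[R]^3 (Fin 7 → R) :=
  wedge3 R 1 2 3 + wedge3 R 4 5 6 + (wedge3 R 0 1 4 + wedge3 R 0 2 5 + wedge3 R 0 3 6)

variable {R}

/-- The natural action of `7 × 7` matrices on `⋀³ R⁷`. -/
def act3 (g : Matrix (Fin 7) (Fin 7) R) : ⋀[R]^3 (Fin 7 → R) →ₗ[R] ⋀[R]^3 (Fin 7 → R) :=
  exteriorPower.map 3 g.mulVecLin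

theorem act3_one : act3 (1 : Matrix (Fin 7) (Fin 7) R) = LinearMap.id := by
  rw [act3, Matrix.mulVecLin_one, exteriorPower.map_id]

theorem act3_mul (g h : Matrix (Fin 7) (Fin 7) R) : act3 (g * h) = act3 g ∘ₗ act3 h := by
  rw [act3, Matrix.mulVecLin_mul, exteriorPower.map_comp]
  rfl

/-- Base change `⋀³ R⁷ → ⋀³ S⁷` along a ring homomorphism. -/
theorem exists_baseChange {S : Type u} [CommRing S] (f : R →+* S) :
    ∃ Φ : ⋀[R]^3 (Fin 7 → R) →ₛₗ[f] ⋀[S]^3 (Fin 7 → S),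
      ∀ v : Fin 3 → Fin 7 → R, Φ (exteriorPower.ιMulti R 3 v) =
        exteriorPower.ιMulti S 3 fun i => f ∘ v i := by
  let _ : Algebra R S := f.toAlgebra
  let _ : Module R (⋀[S]^3 (Fin 7 → S)) := Module.compHom _ f
  let α : (Fin 7 → R) [⋀^Fin 3]→ₗ[R] ⋀[S]^3 (Fin 7 → S) :=
    { toFun := fun v => exteriorPower.ιMulti S 3 fun i => f ∘ v i
      map_update_add' := by
        intro _ v i x y
        have key : ∀ z : Fin 7 → R, (fun j => f ∘ Function.update v i z j) =
            Function.update (fun j => f ∘ v j) i (f ∘ z) := by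
          intro z
          funext j
          by_cases h : j = i
          · subst h; simp
          · simp [h]
        have hadd : f ∘ (x + y) = f ∘ x + f ∘ y := by
          funext j; simp
        obtain rfl : ‹DecidableEq (Fin 3)› = instDecidableEqFin 3 := Subsingleton.elim _ _
        rw [key, key, key, hadd, AlternatingMap.map_update_add]
      map_update_smul' := by
        intro _ v i c x
        have key : ∀ z : Fin 7 → R, (fun j => f ∘ Function.update v i z j) =
            Function.update (fun j => f ∘ v j) i (f ∘ z) := by
          intro z
          funext j
          by_cases h : j = i
          · subst h; simp
          · simp [h]
        have hsm : f ∘ (c • x) = f c • (f ∘ x) := by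
          funext j; simp
        obtain rfl : ‹DecidableEq (Fin 3)› = instDecidableEqFin 3 := Subsingleton.elim _ _
        rw [key, key, hsm, AlternatingMap.map_update_smul]
        rfl
      map_eq_zero_of_eq' := by
        intro v i j hij hne
        exact (exteriorPower.ιMulti S 3).map_eq_zero_of_eq _ (by simp [hij]) hne }
  let Ψ := exteriorPower.alternatingMapLinearEquiv α
  refine ⟨{ toFun := Ψ, map_add' := map_add Ψ, map_smul' := fun c x => ?_ }, fun v => ?_⟩
  · exact Ψ.map_smul c x
  · exact exteriorPower.alternatingMapLinearEquiv_apply_ιMulti α v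

theorem baseChange_wedge3 {S : Type u} [CommRing S] {f : R →+* S}
    {Φ : ⋀[R]^3 (Fin 7 → R) →ₛₗ[f] ⋀[S]^3 (Fin 7 → S)}
    (hΦ : ∀ v : Fin 3 → Fin 7 → R, Φ (exteriorPower.ιMulti R 3 v) =
      exteriorPower.ιMulti S 3 fun i => f ∘ v i) (i j l : Fin 7) :
    Φ (wedge3 R i j l) = wedge3 S i j l := by
  have h : ∀ a : Fin 7, f ∘ stdVec R a = stdVec S a := by
    intro a
    funext b
    simp only [Function.comp_apply, stdVec, Pi.single_apply]
    split <;> simp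
  rw [wedge3, hΦ, wedge3]
  congr 1
  funext a
  fin_cases a <;> simp [h]

theorem baseChange_wBar {S : Type u} [CommRing S] {f : R →+* S}
    {Φ : ⋀[R]^3 (Fin 7 → R) →ₛₗ[f] ⋀[S]^3 (Fin 7 → S)}
    (hΦ : ∀ v : Fin 3 → Fin 7 → R, Φ (exteriorPower.ιMulti R 3 v) =
      exteriorPower.ιMulti S 3 fun i => f ∘ v i) : Φ (wBar R) = wBar S := by
  simp only [wBar, map_add, baseChange_wedge3 hΦ]

theorem baseChange_act3 {S : Type u} [CommRing S] {f : R →+* S}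
    {Φ : ⋀[R]^3 (Fin 7 → R) →ₛₗ[f] ⋀[S]^3 (Fin 7 → S)}
    (hΦ : ∀ v : Fin 3 → Fin 7 → R, Φ (exteriorPower.ιMulti R 3 v) =
      exteriorPower.ιMulti S 3 fun i => f ∘ v i) (g : Matrix (Fin 7) (Fin 7) R)
    (x : ⋀[R]^3 (Fin 7 → R)) : Φ (act3 g x) = act3 (g.map f) (Φ x) := by
  have hx : x ∈ Submodule.span R (Set.range (exteriorPower.ιMulti R 3 (M := Fin 7 → R))) := by
    rw [exteriorPower.ιMulti_span]; trivial
  induction hx using Submodule.span_induction with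
  | mem x hx =>
    obtain ⟨v, rfl⟩ := hx
    rw [act3, act3, exteriorPower.map_apply_ιMulti, hΦ, hΦ, exteriorPower.map_apply_ιMulti]
    congr 1
    funext i
    funext a
    simp only [Function.comp_apply, Matrix.mulVecLin_apply]
    rw [RingHom.map_mulVec]
  | zero => simp
  | add x y _ _ hx hy => simp [hx, hy]
  | smul c x _ hx => simp [hx]

end Trivector

/-- The group `G = {g ∈ GL(7) | g w̄ = c(g) w̄ for some c(g) ∈ GL(1)}`. -/
def G (k : Type u) [Field k] : LinearGroup k 7 where
  points R _ _ :=
    { carrier := {g | ∃ c : Rˣ, act3 g.1 (wBar R) = (c : R) • wBar R}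
      one_mem' := ⟨1, by simp [act3_one]⟩
      mul_mem' := by
        rintro g h ⟨c, hc⟩ ⟨d, hd⟩
        refine ⟨c * d, ?_⟩
        rw [Units.val_mul, act3_mul, LinearMap.comp_apply, hd, map_smul, hc, smul_smul,
          Units.val_mul, mul_comm]
      inv_mem' := by
        rintro g ⟨c, hc⟩
        refine ⟨c⁻¹, ?_⟩
        have h1 : act3 (g⁻¹).1 (act3 g.1 (wBar R)) = wBar R := by
          rw [← LinearMap.comp_apply, ← act3_mul, ← Units.val_mul, inv_mul_cancel, Units.val_one,
            act3_one, LinearMap.id_apply]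
        rw [hc, map_smul] at h1
        conv_rhs => rw [← h1]
        rw [smul_smul, Units.inv_mul, one_smul] }
  map_mem := by
    rintro R S _ _ _ _ f g ⟨c, hc⟩
    refine ⟨Units.map (f : R →* S) c, ?_⟩
    obtain ⟨Φ, hΦ⟩ := exists_baseChange (f : R →+* S)
    have h := congrArg Φ hc
    rw [baseChange_act3 hΦ, map_smulₛₗ, baseChange_wBar hΦ] at h
    exact h

/-- The stabilizer `G_w` in `G` of the vector `w = e₁` of the standard representation. -/
def Gw (k : Type u) [Field k] : LinearGroup k 7 where
  points R _ _ :=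
    { carrier := {g | g ∈ (G k).points R ∧ g.1 *ᵥ stdVec R 0 = stdVec R 0}
      one_mem' := ⟨one_mem _, by simp⟩
      mul_mem' := by
        rintro g h ⟨hg, hg'⟩ ⟨hh, hh'⟩
        refine ⟨mul_mem hg hh, ?_⟩
        rw [Units.val_mul, ← Matrix.mulVec_mulVec, hh', hg']
      inv_mem' := by
        rintro g ⟨hg, hg'⟩
        refine ⟨inv_mem hg, ?_⟩
        conv_lhs => rw [← hg']
        rw [Matrix.mulVec_mulVec, ← Units.val_mul, inv_mul_cancel, Units.val_one,
          Matrix.one_mulVec] }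
  map_mem := by
    rintro R S _ _ _ _ f g ⟨hg, hg'⟩
    refine ⟨(G k).map_mem f g hg, ?_⟩
    have hv : (f : R →+* S) ∘ stdVec R 0 = stdVec S 0 := by
      funext b
      simp only [Function.comp_apply, stdVec, Pi.single_apply]
      split <;> simp
    funext i
    have h := congrArg (f : R →+* S) (congrFun hg' i)
    rw [RingHom.map_mulVec, hv] at h
    exact h.trans (congrFun hv i)

section Embedding

variable {R : Type u} [CommRing R]

/-- The identification of the indices of the block sizes `1, 3, 3` with those of `R⁷`. -/
def blockIdx : Fin 1 ⊕ (Fin 3 ⊕ Fin 3) ≃ Fin 7 :=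
  ((Equiv.refl (Fin 1)).sumCongr finSumFinEquiv).trans finSumFinEquiv

/-- The `7 × 7` matrix with rows of blocks `(1, 0, 0)`, `(0, A₁, A₂)`, `(0, A₃, A₄)`. -/
def block (A₁ A₂ A₃ A₄ : Matrix (Fin 3) (Fin 3) R) : Matrix (Fin 7) (Fin 7) R :=
  Matrix.reindex blockIdx blockIdx
    (Matrix.fromBlocks 1 0 0 (Matrix.fromBlocks A₁ A₂ A₃ A₄))

theorem block_mul (A₁ A₂ A₃ A₄ B₁ B₂ B₃ B₄ : Matrix (Fin 3) (Fin 3) R) :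
    block A₁ A₂ A₃ A₄ * block B₁ B₂ B₃ B₄ =
      block (A₁ * B₁ + A₂ * B₃) (A₁ * B₂ + A₂ * B₄) (A₃ * B₁ + A₄ * B₃) (A₃ * B₂ + A₄ * B₄) := by
  simp only [block, Matrix.reindex_apply, Matrix.submatrix_mul_equiv, Matrix.fromBlocks_multiply]
  simp

theorem block_one : block (1 : Matrix (Fin 3) (Fin 3) R) 0 0 1 = 1 := by
  simp [block]

theorem sl_mul_inv (A : SpecialLinearGroup (Fin 3) R) : A.1 * (A⁻¹).1 = 1 :=
  congrArg Subtype.val (mul_inv_cancel A)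

theorem sl_inv_mul (A : SpecialLinearGroup (Fin 3) R) : (A⁻¹).1 * A.1 = 1 :=
  congrArg Subtype.val (inv_mul_cancel A)

/-- `d(A)` is the block diagonal matrix with blocks `1`, `A`, `ᵗA⁻¹`. -/
def d : SpecialLinearGroup (Fin 3) R →* GL (Fin 7) R where
  toFun A :=
    { val := block A.1 0 0 (A⁻¹).1ᵀ
      inv := block (A⁻¹).1 0 0 A.1ᵀ
      val_inv := by
        rw [block_mul, ← Matrix.transpose_mul, sl_mul_inv]
        simp [block_one]
      inv_val := by
        rw [block_mul, ← Matrix.transpose_mul, sl_inv_mul]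
        simp [block_one] }
  map_one' := by
    apply Units.ext
    have h0 : (1 : SpecialLinearGroup (Fin 3) R)⁻¹ = 1 := inv_one
    have h : ((1 : SpecialLinearGroup (Fin 3) R)⁻¹).1 = 1 := by rw [h0]; rfl
    have h1 : (1 : SpecialLinearGroup (Fin 3) R).1 = 1 := rfl
    simp only [h, h1, Matrix.transpose_one, block_one, Units.val_one]
  map_mul' A B := by
    apply Units.ext
    have h : ((A * B)⁻¹).1 = (B⁻¹).1 * (A⁻¹).1 := congrArg Subtype.val (_root_.mul_inv_rev A B)
    have h1 : (A * B).1 = A.1 * B.1 := rfl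
    simp only [h, h1, Units.val_mul, block_mul, Matrix.transpose_mul]
    simp

/-- `Λ = diag(1, 1, -1)`. -/
def Lam (R : Type u) [CommRing R] : Matrix (Fin 3) (Fin 3) R := Matrix.diagonal ![1, 1, -1]

theorem Lam_mul_Lam : Lam R * Lam R = 1 := by
  rw [Lam, Matrix.diagonal_mul_diagonal, ← Matrix.diagonal_one]
  congr 1
  funext i
  fin_cases i <;> simp

/-- The element `τ` with rows of blocks `(1, 0, 0)`, `(0, 0, Λ)`, `(0, Λ, 0)`. -/
def tau (R : Type u) [CommRing R] : GL (Fin 7) R where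
  val := block 0 (Lam R) (Lam R) 0
  inv := block 0 (Lam R) (Lam R) 0
  val_inv := by rw [block_mul]; simp [Lam_mul_Lam, block_one]
  inv_val := by rw [block_mul]; simp [Lam_mul_Lam, block_one]

end Embedding

/-- The `R`-valued points of the constant group scheme `ℤ/2` (written multiplicatively):
locally constant functions `Spec R → ℤ/2`. -/
abbrev ConstZ2 (R : Type u) [CommRing R] : Type u :=
  LocallyConstant (PrimeSpectrum R) (Multiplicative (ZMod 2))

/-- The map on points of the constant group scheme induced by a ring homomorphism. -/
def ConstZ2.map {R S : Type u} [CommRing R] [CommRing S] (f : R →+* S) :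
    ConstZ2 R →* ConstZ2 S :=
  LocallyConstant.comapMonoidHom ⟨PrimeSpectrum.comap f, PrimeSpectrum.continuous_comap f⟩

/-- The nontrivial constant section of the constant group scheme `ℤ/2`. -/
def ConstZ2.gen (R : Type u) [CommRing R] : ConstZ2 R :=
  LocallyConstant.const _ (Multiplicative.ofAdd 1)

end PrehomG2

end

/-! Pair `wBar` with `α ∧ β ∧ γ`: it becomes an alternating trilinear form on covectors `(a, x,
x')`, equal to `det + det` on the two copies of `R³` plus terms coupling `a` with the dot product of
the copies. A matrix fixing `e₁` has a first row `(1, u, v)` and a `6 × 6` part with rows of blocks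
`(P, S)`, `(Q, T)`, and scaling `wBar` by `c` becomes a set of identities between these
(`act3_wBar_iff`).

These identities can be solved over every commutative ring, with no case distinction. Polarizing the
determinant identity shows that the block matrix of adjugates inverts the `6 × 6` part up to the
unit `c`. Hence `det P • Q = 0`, `det P + det Q = c`, `det T = det P`, `det S = det Q`; then `u = v
= 0` and `P Tᵀ - S Qᵀ = c`. Taking determinants of this last relation, localized by `det P` and by
`det Q`, shows that `e = det P` is idempotent and `c = 2e - 1` (`det_idempotent`).

So `e` splits `G_w` into two open and closed pieces. Where `e = 1`, the blocks `Q` and `S` vanish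
and `T` is the inverse transpose of `P`, so the matrix is `d(P)` (`exists_d_eq`); `τ` has `e = 0`.
The piece `e = 1` is connected because `SL(3)` is generated over fields by transvections, which
deform to `1` along an affine line; this identifies the identity component.

Sections of the constant group `ℤ/2` over `R` correspond to idempotents of `R`. Multiplicativity of
`c = 2e - 1`, with `2` invertible, makes `e` a homomorphism to `ℤ/2`, and `e ↦ e + (1 - e)τ` splits
it. -/

noncomputable section

namespace PrehomG2

open Matrix

/-! ### Trivectors as alternating trilinear forms on covectors. -/

section TrilinearForm

variable {R : Type u} [CommRing R]

/-- The covector of `R⁷` with blocks `a`, `x`, `y` of sizes `1`, `3`, `3`. -/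
def covec (a : R) (x y : Fin 3 → R) : Fin 7 → R :=
  ![a, x 0, x 1, x 2, y 0, y 1, y 2]

omit [CommRing R] in
theorem exists_covec (α : Fin 7 → R) : ∃ a x y, α = covec a x y := by
  refine ⟨α 0, ![α 1, α 2, α 3], ![α 4, α 5, α 6], ?_⟩
  funext i
  fin_cases i <;> rfl

/-- The linear form on `⋀³ R⁷` obtained by pairing with `α ∧ β ∧ γ`. -/
def pairing3 (α β γ : Fin 7 → R) : ⋀[R]^3 (Fin 7 → R) →ₗ[R] R :=
  exteriorPower.pairingDual R (Fin 7 → R) 3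
    (exteriorPower.ιMulti R 3 ![dotProductBilin R R α, dotProductBilin R R β,
      dotProductBilin R R γ])

theorem pairing3_ιMulti (α β γ : Fin 7 → R) (v : Fin 3 → Fin 7 → R) :
    pairing3 α β γ (exteriorPower.ιMulti R 3 v) =
      (Matrix.of fun i j => (![α, β, γ] : Fin 3 → Fin 7 → R) j ⬝ᵥ v i).det := by
  rw [pairing3, exteriorPower.pairingDual_ιMulti_ιMulti]
  congr 1
  ext i j
  fin_cases j <;> rfl

theorem pairing3_act3 (α β γ : Fin 7 → R) (g : Matrix (Fin 7) (Fin 7) R)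
    (x : ⋀[R]^3 (Fin 7 → R)) :
    pairing3 α β γ (act3 g x) = pairing3 (α ᵥ* g) (β ᵥ* g) (γ ᵥ* g) x := by
  suffices h : pairing3 α β γ ∘ₗ act3 g = pairing3 (α ᵥ* g) (β ᵥ* g) (γ ᵥ* g) from
    LinearMap.congr_fun h x
  apply exteriorPower.linearMap_ext
  ext v
  simp only [LinearMap.compAlternatingMap_apply, LinearMap.comp_apply, act3,
    exteriorPower.map_apply_ιMulti, pairing3_ιMulti]
  congr 1
  ext i j
  fin_cases j <;> simp [Matrix.dotProduct_mulVec]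

/-- The coordinates in the standard basis of `⋀³ R⁷` are themselves pairings with wedges of three
coordinate covectors. -/
theorem eq_of_pairing3_eq {x y : ⋀[R]^3 (Fin 7 → R)}
    (h : ∀ α β γ, pairing3 α β γ x = pairing3 α β γ y) : x = y := by
  apply ((Pi.basisFun R (Fin 7)).exteriorPower 3).repr.injective
  ext s
  rw [exteriorPower.basis_repr_apply, exteriorPower.basis_repr_apply]
  have key : ∃ α β γ : Fin 7 → R,
      exteriorPower.ιMultiDual R 3 (Pi.basisFun R (Fin 7)) s = pairing3 α β γ := by
    refine ⟨Pi.single (Set.powersetCard.ofFinEmbEquiv.symm s 0) 1,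
      Pi.single (Set.powersetCard.ofFinEmbEquiv.symm s 1) 1,
      Pi.single (Set.powersetCard.ofFinEmbEquiv.symm s 2) 1, ?_⟩
    rw [exteriorPower.ιMultiDual, pairing3]
    congr 1
    rw [exteriorPower.ιMulti_family]
    congr 1
    funext j
    ext i
    fin_cases j <;> simp [Pi.single_apply, eq_comm]
  obtain ⟨α, β, γ, hs⟩ := key
  rw [hs, h]

/-- The determinant of the matrix with rows `x`, `y`, `z`. -/
def det3 (x y z : Fin 3 → R) : R := (Matrix.of ![x, y, z]).det

theorem det3_apply (x y z : Fin 3 → R) : det3 x y z =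
    x 0 * y 1 * z 2 - x 0 * y 2 * z 1 - x 1 * y 0 * z 2 + x 1 * y 2 * z 0
      + x 2 * y 0 * z 1 - x 2 * y 1 * z 0 := by
  rw [det3, Matrix.det_fin_three]
  simp

theorem det3_vecMul (x y z : Fin 3 → R) (A : Matrix (Fin 3) (Fin 3) R) :
    det3 (x ᵥ* A) (y ᵥ* A) (z ᵥ* A) = det3 x y z * A.det := by
  rw [det3, det3, ← Matrix.det_mul]
  congr 1
  ext i j
  fin_cases i <;> rfl

theorem pairing3_wBar (a b c : R) (x y z x' y' z' : Fin 3 → R) :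
    pairing3 (covec a x x') (covec b y y') (covec c z z') (wBar R) =
      det3 x y z + det3 x' y' z' + a * (y ⬝ᵥ z' - z ⬝ᵥ y') + b * (z ⬝ᵥ x' - x ⬝ᵥ z')
        + c * (x ⬝ᵥ y' - y ⬝ᵥ x') := by
  simp only [wBar, wedge3, map_add, pairing3_ιMulti, det3_apply, Matrix.det_fin_three, stdVec]
  simp [covec, dotProduct, Fin.sum_univ_succ]
  ring

end TrilinearForm

/-! ### Solving the block equations over a commutative ring. -/

section BlockEquations

variable {R : Type u} [CommRing R]

/-- The second exterior power of a `3 × 3` matrix is its adjugate, once `⋀² R³` is identified with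
`R³` by the cross product. This is how adjugates enter. -/
theorem det3_vecMul_right (w y z : Fin 3 → R) (A : Matrix (Fin 3) (Fin 3) R) :
    det3 w (y ᵥ* A) (z ᵥ* A) = w ⬝ᵥ (A.adjugate *ᵥ (crossProduct y z)) := by
  rw [det3_apply, Matrix.adjugate_fin_three, cross_apply]
  simp [Matrix.mulVec, Matrix.vecMul, dotProduct, Fin.sum_univ_succ]
  ring

theorem eq_zero_of_det3_eq_zero {w : Fin 3 → R} (h : ∀ x y, det3 w x y = 0) : w = 0 := by
  funext i
  have h0 := h ![0, 1, 0] ![0, 0, 1]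
  have h1 := h ![0, 0, 1] ![1, 0, 0]
  have h2 := h ![1, 0, 0] ![0, 1, 0]
  simp only [det3_apply] at h0 h1 h2
  fin_cases i
  · simpa using h0
  · simpa using h1
  · simpa using h2

theorem det3_zero_left (x y : Fin 3 → R) : det3 0 x y = 0 := by simp [det3_apply]

theorem det3_zero_middle (x y : Fin 3 → R) : det3 x 0 y = 0 := by simp [det3_apply]

theorem det3_zero_right (x y : Fin 3 → R) : det3 x y 0 = 0 := by simp [det3_apply]

theorem det3_rotate (x y z : Fin 3 → R) : det3 x y z = det3 y z x := by
  simp only [det3_apply]; ring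

theorem det3_smul_left (r : R) (x y z : Fin 3 → R) : det3 (r • x) y z = r * det3 x y z := by
  simp only [det3_apply, Pi.smul_apply, smul_eq_mul]; ring

theorem det3_smul_right (r : R) (x y z : Fin 3 → R) : det3 x y (r • z) = r * det3 x y z := by
  simp only [det3_apply, Pi.smul_apply, smul_eq_mul]; ring

theorem eq_zero_of_dotProduct_mulVec_cross {M : Matrix (Fin 3) (Fin 3) R}
    (h : ∀ w y z, w ⬝ᵥ (M *ᵥ (crossProduct y z)) = 0) : M = 0 := by
  have key : ∀ j : Fin 3, ∃ y z : Fin 3 → R, crossProduct y z = Pi.single j 1 := by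
    intro j
    fin_cases j
    · exact ⟨![0, 1, 0], ![0, 0, 1], by ext i; fin_cases i <;> simp [cross_apply]⟩
    · exact ⟨![0, 0, 1], ![1, 0, 0], by ext i; fin_cases i <;> simp [cross_apply]⟩
    · exact ⟨![1, 0, 0], ![0, 1, 0], by ext i; fin_cases i <;> simp [cross_apply]⟩
  ext i j
  obtain ⟨y, z, hyz⟩ := key j
  have := h (Pi.single i 1) y z
  rw [hyz] at this
  simpa using this

/-- The `6 × 6` matrix with rows of blocks `(P, S)`, `(Q, T)`, acting on row vectors from the right,
multiplies the sum of the determinants of the two factors of `R³ × R³` by `c`. -/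
def IsDetSumSimilitude (P Q S T : Matrix (Fin 3) (Fin 3) R) (c : R) : Prop :=
  ∀ x y z x' y' z' : Fin 3 → R,
    det3 (x ᵥ* P + x' ᵥ* Q) (y ᵥ* P + y' ᵥ* Q) (z ᵥ* P + z' ᵥ* Q) +
      det3 (x ᵥ* S + x' ᵥ* T) (y ᵥ* S + y' ᵥ* T) (z ᵥ* S + z' ᵥ* T) =
    c * (det3 x y z + det3 x' y' z')

namespace IsDetSumSimilitude

variable {P Q S T : Matrix (Fin 3) (Fin 3) R} {c : R}

theorem swap_source (h : IsDetSumSimilitude P Q S T c) : IsDetSumSimilitude Q P T S c := by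
  intro x y z x' y' z'
  have := h x' y' z' x y z
  simp only [add_comm (_ ᵥ* P), add_comm (_ ᵥ* S), add_comm (det3 x' y' z')] at this
  exact this

theorem swap_target (h : IsDetSumSimilitude P Q S T c) : IsDetSumSimilitude S T P Q c := by
  intro x y z x' y' z'
  rw [add_comm]
  exact h x y z x' y' z'

theorem det_add_det (h : IsDetSumSimilitude P Q S T c) : P.det + S.det = c := by
  have := h ![1, 0, 0] ![0, 1, 0] ![0, 0, 1] 0 0 0
  have h1 : det3 ![1, 0, 0] ![0, 1, 0] ![0, 0, (1 : R)] = 1 := by simp [det3_apply]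
  simpa [det3_vecMul, h1, det3_zero_left] using this

theorem mul_adjugate_add (h : IsDetSumSimilitude P Q S T c) :
    Q * P.adjugate + T * S.adjugate = 0 := by
  apply eq_zero_of_dotProduct_mulVec_cross
  intro w y z
  -- Mixed arguments: one vector in the second factor, two in the first, so the right side vanishes.
  have := h 0 y z w 0 0
  simp only [Matrix.zero_vecMul, zero_add, add_zero, det3_vecMul_right, det3_zero_left,
    det3_zero_right, mul_zero] at this
  rw [Matrix.add_mulVec, dotProduct_add, ← Matrix.mulVec_mulVec, ← Matrix.mulVec_mulVec,
    Matrix.dotProduct_mulVec _ Q, Matrix.dotProduct_mulVec _ T, this]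

theorem fromBlocks_mul_adjugate (h : IsDetSumSimilitude P Q S T c) :
    fromBlocks P S Q T * fromBlocks P.adjugate Q.adjugate S.adjugate T.adjugate =
      c • (1 : Matrix (Fin 3 ⊕ Fin 3) (Fin 3 ⊕ Fin 3) R) := by
  rw [Matrix.fromBlocks_multiply, h.mul_adjugate_add, h.swap_source.mul_adjugate_add]
  simp only [Matrix.mul_adjugate]
  rw [← add_smul, ← add_smul, h.det_add_det, h.swap_source.det_add_det,
    ← Matrix.fromBlocks_one, Matrix.fromBlocks_smul, smul_zero]

theorem fromBlocks_adjugate_mul (h : IsDetSumSimilitude P Q S T c) (hc : IsUnit c) :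
    fromBlocks P.adjugate Q.adjugate S.adjugate T.adjugate * fromBlocks P S Q T =
      c • (1 : Matrix (Fin 3 ⊕ Fin 3) (Fin 3 ⊕ Fin 3) R) := by
  obtain ⟨c, rfl⟩ := hc
  have h1 := h.fromBlocks_mul_adjugate
  have h2 : fromBlocks P S Q T *
      ((↑c⁻¹ : R) • fromBlocks P.adjugate Q.adjugate S.adjugate T.adjugate) = 1 := by
    rw [Matrix.mul_smul, h1, smul_smul, Units.inv_mul, one_smul]
  -- A one-sided inverse of a square matrix over a commutative ring is two-sided; this yields the
  -- relations with the adjugates on the left.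
  have h3 := mul_eq_one_comm.mp h2
  rw [← h3, Matrix.smul_mul, smul_smul, Units.mul_inv, one_smul]

theorem adjugate_mul_add (h : IsDetSumSimilitude P Q S T c) (hc : IsUnit c) :
    P.adjugate * P + Q.adjugate * Q = c • (1 : Matrix (Fin 3) (Fin 3) R) ∧
      P.adjugate * S + Q.adjugate * T = 0 := by
  have := h.fromBlocks_adjugate_mul hc
  rw [Matrix.fromBlocks_multiply, ← Matrix.fromBlocks_one, Matrix.fromBlocks_smul] at this
  have := Matrix.fromBlocks_inj.mp this
  exact ⟨this.1, by simpa using this.2.1⟩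

theorem det_add_det' (h : IsDetSumSimilitude P Q S T c) (hc : IsUnit c) :
    P.det + Q.det = c := by
  have := congrFun (congrFun (h.adjugate_mul_add hc).1 0) 0
  simpa [Matrix.adjugate_mul] using this

theorem det3_eq_zero (h : IsDetSumSimilitude P Q S T c) (hc : IsUnit c) (x y z : Fin 3 → R) :
    det3 (x ᵥ* P) (y ᵥ* Q) z = 0 := by
  obtain ⟨h1, h2⟩ := h.adjugate_mul_add hc
  -- The third vector is chosen so that its image is `(c • z, 0)`: only the first determinant
  -- survives on the left, while the right side is zero.
  have := h x 0 (z ᵥ* P.adjugate) 0 y (z ᵥ* Q.adjugate)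
  simp only [Matrix.zero_vecMul, add_zero, zero_add, Matrix.vecMul_vecMul, ← Matrix.vecMul_add,
    h1, h2, Matrix.vecMul_zero, det3_zero_left, det3_zero_middle, det3_zero_right, mul_zero,
    Matrix.vecMul_smul, Matrix.vecMul_one, det3_smul_right] at this
  exact (hc.mul_right_eq_zero).mp this

theorem det_smul_eq_zero (h : IsDetSumSimilitude P Q S T c) (hc : IsUnit c) :
    P.det • Q = 0 := by
  have key : ∀ y : Fin 3 → R, P.det • (y ᵥ* Q) = 0 := by
    intro y
    apply eq_zero_of_det3_eq_zero
    intro z x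
    -- Multiplying by the adjugate turns `x ᵥ* P` into `det P • x`, an arbitrary vector up to the
    -- factor `det P`.
    have := h.det3_eq_zero hc (x ᵥ* P.adjugate) y z
    rw [Matrix.vecMul_vecMul, Matrix.adjugate_mul, Matrix.vecMul_smul, Matrix.vecMul_one,
      det3_smul_left] at this
    rw [det3_smul_left, ← det3_rotate, this]
  ext i j
  have := congrFun (key (Pi.single i 1)) j
  simpa using this

end IsDetSumSimilitude

/-- Conditions on the blocks of a `7 × 7` matrix with first column `e₁` which say that it
multiplies the trivector `wBar` by `c`. -/
structure IsTrivectorSimilitude (P Q S T : Matrix (Fin 3) (Fin 3) R) (u v : Fin 3 → R) (c : R) :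
    Prop where
  det_sum : IsDetSumSimilitude P Q S T c
  pairing : ∀ y y' z z' : Fin 3 → R,
    det3 u (y ᵥ* P + y' ᵥ* Q) (z ᵥ* P + z' ᵥ* Q) + det3 v (y ᵥ* S + y' ᵥ* T) (z ᵥ* S + z' ᵥ* T) +
      ((y ᵥ* P + y' ᵥ* Q) ⬝ᵥ (z ᵥ* S + z' ᵥ* T) - (z ᵥ* P + z' ᵥ* Q) ⬝ᵥ (y ᵥ* S + y' ᵥ* T)) =
    c * (y ⬝ᵥ z' - z ⬝ᵥ y')

namespace IsTrivectorSimilitude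

variable {P Q S T : Matrix (Fin 3) (Fin 3) R} {u v : Fin 3 → R} {c : R}

theorem det_relations (h : IsTrivectorSimilitude P Q S T u v c) (hc : IsUnit c) :
    T.det = P.det ∧ S.det = Q.det ∧ P.det + Q.det = c ∧ P.det * Q.det = 0 := by
  have h1 := h.det_sum.det_add_det
  have h2 := h.det_sum.swap_source.det_add_det
  have h3 := h.det_sum.det_add_det' hc
  have h4 := congrArg (fun M => (M * Q.adjugate) 0 0) (h.det_sum.det_smul_eq_zero hc)
  refine ⟨by linear_combination h2 - h3, by linear_combination h1 - h3, h3, ?_⟩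
  simpa [Matrix.mul_adjugate] using h4

/-- Multiplying the identity by `det M` kills every term containing `N`. Adjugates then clear `M`
from the two remaining arguments at the cost of two more factors `det M`. The sign `r` allows for
exchanging the two factors of `R³ × R³`. -/
theorem det_pow_smul_eq_zero {M N : Matrix (Fin 3) (Fin 3) R} {w w' : Fin 3 → R} (r : R)
    (hN : M.det • N = 0)
    (h : ∀ y z : Fin 3 → R, det3 w (y ᵥ* M) (z ᵥ* M) + det3 w' (y ᵥ* N) (z ᵥ* N) +
      r * ((y ᵥ* M) ⬝ᵥ (z ᵥ* N) - (z ᵥ* M) ⬝ᵥ (y ᵥ* N)) = 0) : M.det ^ 3 • w = 0 := by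
  have hv : ∀ y : Fin 3 → R, M.det • (y ᵥ* N) = 0 := by
    intro y; rw [← Matrix.vecMul_smul, hN, Matrix.vecMul_zero]
  have h1 : ∀ y z : Fin 3 → R, M.det * det3 w (y ᵥ* M) (z ᵥ* M) = 0 := by
    intro y z
    have h2 : M.det * det3 w' (y ᵥ* N) (z ᵥ* N) = 0 := by
      rw [← det3_smul_right, hv, det3_zero_right]
    have h3 : M.det * ((y ᵥ* M) ⬝ᵥ (z ᵥ* N)) = 0 := by
      rw [← smul_eq_mul, ← dotProduct_smul, hv, dotProduct_zero]
    have h4 : M.det * ((z ᵥ* M) ⬝ᵥ (y ᵥ* N)) = 0 := by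
      rw [← smul_eq_mul, ← dotProduct_smul, hv, dotProduct_zero]
    linear_combination M.det * h y z - h2 - r * h3 + r * h4
  apply eq_zero_of_det3_eq_zero
  intro y z
  have := h1 (y ᵥ* M.adjugate) (z ᵥ* M.adjugate)
  rw [Matrix.vecMul_vecMul, Matrix.vecMul_vecMul, Matrix.adjugate_mul, Matrix.vecMul_smul,
    Matrix.vecMul_smul, Matrix.vecMul_one, Matrix.vecMul_one, det3_smul_right,
    det3_rotate, det3_smul_left, ← det3_rotate] at this
  rw [det3_smul_left, ← this]
  ring

theorem vectors_eq_zero (h : IsTrivectorSimilitude P Q S T u v c) (hc : IsUnit c) :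
    u = 0 ∧ v = 0 := by
  obtain ⟨hT, hS, hPQ, hz⟩ := h.det_relations hc
  have hd := h.det_sum
  -- Since `det P * det Q = 0`, the sum of cubes is `c ^ 3`; thus `u` and `v` vanish once both cubes
  -- annihilate them.
  have hc3 : IsUnit (P.det ^ 3 + Q.det ^ 3) := by
    have : P.det ^ 3 + Q.det ^ 3 = c ^ 3 := by
      rw [← hPQ]; linear_combination (-3 * (P.det + Q.det)) * hz
    rw [this]
    exact hc.pow 3
  have hPS : P.det • S = 0 := by rw [← hT]; exact hd.swap_source.swap_target.det_smul_eq_zero hc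
  have hQT : Q.det • T = 0 := by rw [← hS]; exact hd.swap_target.det_smul_eq_zero hc
  have hSP : S.det • P = 0 := by rw [hS]; exact hd.swap_source.det_smul_eq_zero hc
  have hTQ : T.det • Q = 0 := by rw [hT]; exact hd.det_smul_eq_zero hc
  have e1 : P.det ^ 3 • u = 0 := det_pow_smul_eq_zero 1 hPS (w' := v) fun y z => by
    simpa using h.pairing y 0 z 0
  have e2 : S.det ^ 3 • v = 0 := det_pow_smul_eq_zero (-1) hSP (w' := u) fun y z => by
    have := h.pairing y 0 z 0
    simp only [Matrix.zero_vecMul, add_zero, dotProduct_zero, sub_zero, mul_zero] at this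
    rw [dotProduct_comm (y ᵥ* S), dotProduct_comm (z ᵥ* S)]
    linear_combination this
  have e3 : Q.det ^ 3 • u = 0 := det_pow_smul_eq_zero 1 hQT (w' := v) fun y z => by
    simpa using h.pairing 0 y 0 z
  have e4 : T.det ^ 3 • v = 0 := det_pow_smul_eq_zero (-1) hTQ (w' := u) fun y z => by
    have := h.pairing 0 y 0 z
    simp only [Matrix.zero_vecMul, zero_add, zero_dotProduct, sub_zero, mul_zero] at this
    rw [dotProduct_comm (y ᵥ* T), dotProduct_comm (z ᵥ* T)]
    linear_combination this
  rw [hS] at e2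
  rw [hT] at e4
  refine ⟨hc3.smul_eq_zero.mp ?_, hc3.smul_eq_zero.mp ?_⟩
  · rw [add_smul, e1, e3, add_zero]
  · rw [add_smul, e2, e4, add_zero]

theorem mul_transpose_sub (h : IsTrivectorSimilitude P Q S T u v c) (hc : IsUnit c) :
    P * Tᵀ - S * Qᵀ = c • (1 : Matrix (Fin 3) (Fin 3) R) := by
  obtain ⟨rfl, rfl⟩ := h.vectors_eq_zero hc
  ext i j
  -- With `u = v = 0` only the dot products remain; basis vectors from opposite factors read off the
  -- `(i, j)` entry.
  have := h.pairing (Pi.single i 1) 0 0 (Pi.single j 1)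
  simp only [det3_zero_left, Matrix.zero_vecMul, add_zero, zero_add, dotProduct_zero,
    sub_zero, Matrix.single_one_vecMul] at this
  have e : (Pi.single i 1 : Fin 3 → R) ⬝ᵥ Pi.single j 1 = (1 : Matrix (Fin 3) (Fin 3) R) i j := by
    simp [Matrix.one_apply, Pi.single_apply, eq_comm]
  rw [e, dotProduct_comm (Q.row j)] at this
  exact this

theorem det_idempotent (h : IsTrivectorSimilitude P Q S T u v c) (hc : IsUnit c) :
    IsIdempotentElem P.det ∧ c = 2 * P.det - 1 := by
  obtain ⟨hT, hS, hPQ, hz⟩ := h.det_relations hc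
  have hd := h.det_sum
  have hPS : P.det • S = 0 := by rw [← hT]; exact hd.swap_source.swap_target.det_smul_eq_zero hc
  have hQP : Q.det • P = 0 := hd.swap_source.det_smul_eq_zero hc
  have hM := h.mul_transpose_sub hc
  have e1 : P.det • (P * Tᵀ) = (P.det * c) • (1 : Matrix (Fin 3) (Fin 3) R) := by
    rw [mul_smul, ← hM, smul_sub, ← Matrix.smul_mul P.det S, hPS, Matrix.zero_mul, sub_zero]
  have e2 : Q.det • (S * Qᵀ) = (-(Q.det * c)) • (1 : Matrix (Fin 3) (Fin 3) R) := by
    rw [neg_smul, mul_smul, ← hM, smul_sub, ← Matrix.smul_mul Q.det P, hQP, Matrix.zero_mul,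
      zero_sub, neg_neg]
  have f1 := congrArg Matrix.det e1
  have f2 := congrArg Matrix.det e2
  simp only [Matrix.det_smul, Matrix.det_mul, Matrix.det_transpose, hT, hS, Matrix.det_one,
    Fintype.card_fin, mul_one] at f1 f2
  generalize P.det = p at *
  generalize Q.det = q at *
  -- Now `f1` reads `p ^ 5 = (p * c) ^ 3 = p ^ 6` and `f2` reads `q ^ 5 = -q ^ 6`. As `p ^ 5 = c ^ 4
  -- * p` and `p ^ 6 = c ^ 4 * (p * c)`, and likewise for `q`, cancelling `c ^ 4` gives `p * c = p`
  -- and `q * c = -q`.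
  have hp : p * c = p ^ 2 := by rw [← hPQ]; linear_combination hz
  have hq : q * c = q ^ 2 := by rw [← hPQ]; linear_combination hz
  have g1 : p * c = p := by
    have : c ^ 4 * (p * c) = c ^ 4 * p := by
      linear_combination (c ^ 4 + p * c ^ 3 + p ^ 2 * c ^ 2 + p ^ 3 * c + p ^ 4) * hp
        - (c ^ 3 + p * c ^ 2 + p ^ 2 * c + p ^ 3) * hp - f1
        - ((p * c) ^ 2 + p * c * p ^ 2 + p ^ 4) * hp
    exact (hc.pow 4).mul_left_cancel this
  have g2 : q * c = -q := by
    have : c ^ 4 * (q * c) = c ^ 4 * (-q) := by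
      linear_combination (c ^ 4 + q * c ^ 3 + q ^ 2 * c ^ 2 + q ^ 3 * c + q ^ 4) * hq
        + (c ^ 3 + q * c ^ 2 + q ^ 2 * c + q ^ 3) * hq + f2
        - ((q * c) ^ 2 + q * c * q ^ 2 + q ^ 4) * hq
    exact (hc.pow 4).mul_left_cancel this
  have hp2 : p * p = p := by rw [← pow_two, ← hp, g1]
  refine ⟨hp2, ?_⟩
  have : c * c = c * (2 * p - 1) := by
    linear_combination (-c) * hPQ - g1 + g2 - hPQ
  exact hc.mul_left_cancel this

end IsTrivectorSimilitude
end BlockEquations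

/-! ### The stabilizer of `e₁` in block form. -/

section Stabilizer

variable {R : Type u} [CommRing R]

/-- The block of a `7 × 7` matrix with the given rows and columns. -/
def block11 (g : Matrix (Fin 7) (Fin 7) R) : Matrix (Fin 3) (Fin 3) R :=
  g.submatrix ![1, 2, 3] ![1, 2, 3]

/-- The block of a `7 × 7` matrix with the given rows and columns. -/
def block12 (g : Matrix (Fin 7) (Fin 7) R) : Matrix (Fin 3) (Fin 3) R :=
  g.submatrix ![1, 2, 3] ![4, 5, 6]

/-- The block of a `7 × 7` matrix with the given rows and columns. -/
def block21 (g : Matrix (Fin 7) (Fin 7) R) : Matrix (Fin 3) (Fin 3) R :=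
  g.submatrix ![4, 5, 6] ![1, 2, 3]

/-- The block of a `7 × 7` matrix with the given rows and columns. -/
def block22 (g : Matrix (Fin 7) (Fin 7) R) : Matrix (Fin 3) (Fin 3) R :=
  g.submatrix ![4, 5, 6] ![4, 5, 6]

theorem mulVec_stdVec_zero_iff (g : Matrix (Fin 7) (Fin 7) R) :
    g *ᵥ stdVec R 0 = stdVec R 0 ↔ ∀ i, g i 0 = if i = 0 then 1 else 0 := by
  rw [stdVec, Matrix.mulVec_single_one, funext_iff]
  simp [Matrix.col, Pi.single_apply]

theorem covec_vecMul {g : Matrix (Fin 7) (Fin 7) R} (hg : g *ᵥ stdVec R 0 = stdVec R 0)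
    (a : R) (x y : Fin 3 → R) : covec a x y ᵥ* g =
      covec a (a • (g 0 ∘ ![1, 2, 3]) + (x ᵥ* block11 g + y ᵥ* block21 g))
        (a • (g 0 ∘ ![4, 5, 6]) + (x ᵥ* block12 g + y ᵥ* block22 g)) := by
  rw [mulVec_stdVec_zero_iff] at hg
  have h0 : g 0 0 = 1 := hg 0
  have h1 : g 1 0 = 0 := hg 1
  have h2 : g 2 0 = 0 := hg 2
  have h3 : g 3 0 = 0 := hg 3
  have h4 : g 4 0 = 0 := hg 4
  have h5 : g 5 0 = 0 := hg 5
  have h6 : g 6 0 = 0 := hg 6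
  have key : ∀ j : Fin 7, (covec a x y ᵥ* g) j = a * g 0 j + (x 0 * g 1 j + x 1 * g 2 j +
      x 2 * g 3 j + (y 0 * g 4 j + y 1 * g 5 j + y 2 * g 6 j)) := by
    intro j
    rw [Matrix.vecMul, dotProduct, Fin.sum_univ_seven]
    simp only [covec, Matrix.cons_val]
    ring
  have key' : ∀ (i : Fin 3 → Fin 7) (j : Fin 3),
      (a • (g 0 ∘ i) + (x ᵥ* g.submatrix ![1, 2, 3] i + y ᵥ* g.submatrix ![4, 5, 6] i)) j =
        a * g 0 (i j) + (x 0 * g 1 (i j) + x 1 * g 2 (i j) + x 2 * g 3 (i j) +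
          (y 0 * g 4 (i j) + y 1 * g 5 (i j) + y 2 * g 6 (i j))) := by
    intro i j
    simp only [Pi.add_apply, Pi.smul_apply, smul_eq_mul, Function.comp_apply, Matrix.vecMul,
      dotProduct, Fin.sum_univ_three, Matrix.submatrix_apply, Matrix.cons_val]
  funext j
  rw [key]
  fin_cases j
  · change a * g 0 0 + (x 0 * g 1 0 + x 1 * g 2 0 + x 2 * g 3 0 +
      (y 0 * g 4 0 + y 1 * g 5 0 + y 2 * g 6 0)) = a
    rw [h0, h1, h2, h3, h4, h5, h6]
    ring
  · exact (key' ![1, 2, 3] 0).symm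
  · exact (key' ![1, 2, 3] 1).symm
  · exact (key' ![1, 2, 3] 2).symm
  · exact (key' ![4, 5, 6] 0).symm
  · exact (key' ![4, 5, 6] 1).symm
  · exact (key' ![4, 5, 6] 2).symm

theorem det3_expand (a b c : R) (w x y z : Fin 3 → R) :
    det3 (a • w + x) (b • w + y) (c • w + z) =
      det3 x y z + a * det3 w y z + b * det3 w z x + c * det3 w x y := by
  simp only [det3_apply, Pi.add_apply, Pi.smul_apply, smul_eq_mul]
  ring

/-- All contributions of `u` and `v` cancel by alternation, so the first row affects the form only
through the determinants. -/
theorem dotProduct_det3_expand (a b c : R) (u v x y z x' y' z' : Fin 3 → R) :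
    a * ((b • u + y) ⬝ᵥ (c • v + z') - (c • u + z) ⬝ᵥ (b • v + y')) +
      b * ((c • u + z) ⬝ᵥ (a • v + x') - (a • u + x) ⬝ᵥ (c • v + z')) +
      c * ((a • u + x) ⬝ᵥ (b • v + y') - (b • u + y) ⬝ᵥ (a • v + x')) =
    a * (y ⬝ᵥ z' - z ⬝ᵥ y') + b * (z ⬝ᵥ x' - x ⬝ᵥ z') + c * (x ⬝ᵥ y' - y ⬝ᵥ x') := by
  simp only [add_dotProduct, dotProduct_add, smul_dotProduct, dotProduct_smul, smul_eq_mul]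
  ring

theorem act3_wBar_iff {g : Matrix (Fin 7) (Fin 7) R} (hg : g *ᵥ stdVec R 0 = stdVec R 0) (c : R) :
    act3 g (wBar R) = c • wBar R ↔ IsTrivectorSimilitude (block11 g) (block21 g) (block12 g)
      (block22 g) (g 0 ∘ ![1, 2, 3]) (g 0 ∘ ![4, 5, 6]) c := by
  constructor
  · intro h
    have key : ∀ α β γ : Fin 7 → R, pairing3 (α ᵥ* g) (β ᵥ* g) (γ ᵥ* g) (wBar R) =
        c * pairing3 α β γ (wBar R) := by
      intro α β γ
      rw [← pairing3_act3, h, map_smul, smul_eq_mul]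
    -- Covectors with first coordinate `0` give the determinant identity; replacing one of them by
    -- `(1, 0, 0)` gives the pairing identity.
    refine ⟨fun x y z x' y' z' => ?_, fun y y' z z' => ?_⟩
    · have := key (covec 0 x x') (covec 0 y y') (covec 0 z z')
      simpa only [covec_vecMul hg, pairing3_wBar, zero_mul, add_zero, zero_smul, zero_add] using this
    · have := key (covec 1 0 0) (covec 0 y y') (covec 0 z z')
      simpa only [covec_vecMul hg, pairing3_wBar, zero_mul, add_zero, zero_smul, zero_add,
        one_mul, one_smul, Matrix.zero_vecMul, det3_zero_left] using this
  · intro h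
    apply eq_of_pairing3_eq
    intro α β γ
    obtain ⟨a, x, x', rfl⟩ := exists_covec α
    obtain ⟨b, y, y', rfl⟩ := exists_covec β
    obtain ⟨e, z, z', rfl⟩ := exists_covec γ
    rw [pairing3_act3, map_smul, covec_vecMul hg, covec_vecMul hg, covec_vecMul hg,
      pairing3_wBar, pairing3_wBar, smul_eq_mul, det3_expand, det3_expand]
    linear_combination h.det_sum x y z x' y' z' + a * h.pairing y y' z z' +
      b * h.pairing z z' x x' + e * h.pairing x x' y y' +
      dotProduct_det3_expand a b e (g 0 ∘ ![1, 2, 3]) (g 0 ∘ ![4, 5, 6])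
        (x ᵥ* block11 g + x' ᵥ* block21 g) (y ᵥ* block11 g + y' ᵥ* block21 g)
        (z ᵥ* block11 g + z' ᵥ* block21 g) (x ᵥ* block12 g + x' ᵥ* block22 g)
        (y ᵥ* block12 g + y' ᵥ* block22 g) (z ᵥ* block12 g + z' ᵥ* block22 g)

theorem smul_wBar_injective {a b : R} (h : a • wBar R = b • wBar R) : a = b := by
  have := congrArg (pairing3 (covec 0 ![1, 0, 0] 0) (covec 0 ![0, 1, 0] 0)
    (covec 0 ![0, 0, 1] 0)) h
  simpa [pairing3_wBar, det3_apply] using this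

variable (A₁ A₂ A₃ A₄ : Matrix (Fin 3) (Fin 3) R)

theorem block11_block : block11 (block A₁ A₂ A₃ A₄) = A₁ := by
  ext i j; fin_cases i <;> fin_cases j <;> rfl

theorem block12_block : block12 (block A₁ A₂ A₃ A₄) = A₂ := by
  ext i j; fin_cases i <;> fin_cases j <;> rfl

theorem block21_block : block21 (block A₁ A₂ A₃ A₄) = A₃ := by
  ext i j; fin_cases i <;> fin_cases j <;> rfl

theorem block22_block : block22 (block A₁ A₂ A₃ A₄) = A₄ := by
  ext i j; fin_cases i <;> fin_cases j <;> rfl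

theorem block_row_zero :
    block A₁ A₂ A₃ A₄ 0 ∘ ![1, 2, 3] = 0 ∧ block A₁ A₂ A₃ A₄ 0 ∘ ![4, 5, 6] = 0 := by
  constructor <;> (funext j; fin_cases j <;> rfl)

theorem block_mulVec_stdVec_zero : block A₁ A₂ A₃ A₄ *ᵥ stdVec R 0 = stdVec R 0 := by
  rw [mulVec_stdVec_zero_iff]
  intro i
  fin_cases i <;> rfl

theorem eq_block {g : Matrix (Fin 7) (Fin 7) R} (hg : g *ᵥ stdVec R 0 = stdVec R 0)
    (hu : g 0 ∘ ![1, 2, 3] = 0) (hv : g 0 ∘ ![4, 5, 6] = 0) :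
    g = block (block11 g) (block12 g) (block21 g) (block22 g) := by
  rw [mulVec_stdVec_zero_iff] at hg
  ext i j
  have hu0 := congrFun hu 0
  have hu1 := congrFun hu 1
  have hu2 := congrFun hu 2
  have hv0 := congrFun hv 0
  have hv1 := congrFun hv 1
  have hv2 := congrFun hv 2
  fin_cases j
  · exact (hg i).trans (by fin_cases i <;> rfl)
  all_goals fin_cases i <;> first | rfl | assumption

theorem act3_block_wBar {c : R}
    (h : IsTrivectorSimilitude A₁ A₃ A₂ A₄ 0 0 c) :
    act3 (block A₁ A₂ A₃ A₄) (wBar R) = c • wBar R := by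
  rw [act3_wBar_iff (block_mulVec_stdVec_zero A₁ A₂ A₃ A₄), block11_block, block12_block,
    block21_block, block22_block, (block_row_zero A₁ A₂ A₃ A₄).1, (block_row_zero A₁ A₂ A₃ A₄).2]
  exact h

theorem act3_d_wBar (A : SpecialLinearGroup (Fin 3) R) :
    act3 (d A).1 (wBar R) = (1 : R) • wBar R := by
  apply act3_block_wBar
  refine ⟨fun x y z x' y' z' => ?_, fun y y' z z' => ?_⟩
  · simp only [Matrix.vecMul_zero, add_zero, zero_add, det3_vecMul, Matrix.det_transpose]
    rw [A.2, A⁻¹.2]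
    ring
  · have key : ∀ y z : Fin 3 → R, (y ᵥ* A.1) ⬝ᵥ (z ᵥ* (A⁻¹).1ᵀ) = y ⬝ᵥ z := by
      intro y z
      rw [Matrix.vecMul_transpose, ← Matrix.dotProduct_mulVec, Matrix.mulVec_mulVec, sl_mul_inv,
        Matrix.one_mulVec]
    simp only [Matrix.vecMul_zero, add_zero, zero_add, det3_zero_left, key]
    ring

theorem det_Lam : (Lam R).det = -1 := by
  simp [Lam, Matrix.det_diagonal, Fin.prod_univ_succ]

theorem act3_tau_wBar : act3 (tau R).1 (wBar R) = (-1 : R) • wBar R := by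
  apply act3_block_wBar
  refine ⟨fun x y z x' y' z' => ?_, fun y y' z z' => ?_⟩
  · simp only [Matrix.vecMul_zero, add_zero, zero_add, det3_vecMul, det_Lam]
    ring
  · have key : ∀ y z : Fin 3 → R, (y ᵥ* Lam R) ⬝ᵥ (z ᵥ* Lam R) = z ⬝ᵥ y := by
      intro y z
      have ht : (Lam R)ᵀ = Lam R := Matrix.diagonal_transpose _
      conv_lhs => rw [← ht, Matrix.vecMul_transpose, ht]
      rw [dotProduct_comm, ← Matrix.dotProduct_mulVec, Matrix.mulVec_mulVec, Lam_mul_Lam,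
        Matrix.one_mulVec]
    simp only [Matrix.vecMul_zero, add_zero, zero_add, det3_zero_left, key]
    ring

/-- The regular function on `G_w` which is `1` on the identity component and `0` on the other
component: the determinant of the upper left `3 × 3` block. -/
def componentFun (g : Matrix (Fin 7) (Fin 7) R) : R := (block11 g).det

theorem componentFun_d (A : SpecialLinearGroup (Fin 3) R) : componentFun (d A).1 = 1 := by
  exact (congrArg Matrix.det (block11_block _ _ _ _)).trans A.2

theorem componentFun_tau : componentFun (tau R).1 = 0 := by
  refine (congrArg Matrix.det (block11_block _ _ _ _)).trans ?_
  simp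

theorem componentFun_map {S : Type u} [CommRing S] (f : R →+* S) (g : Matrix (Fin 7) (Fin 7) R) :
    componentFun (g.map f) = f (componentFun g) := by
  rw [componentFun, componentFun, RingHom.map_det]
  rfl

variable {k : Type u} [Field k] [Algebra k R]

theorem d_mem_Gw (A : SpecialLinearGroup (Fin 3) R) : d A ∈ (Gw k).points R :=
  ⟨⟨1, act3_d_wBar A⟩, block_mulVec_stdVec_zero _ _ _ _⟩

theorem isIdempotentElem_componentFun {g : GL (Fin 7) R} (hg : g ∈ (Gw k).points R) :
    IsIdempotentElem (componentFun g.1) := by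
  obtain ⟨⟨c, hc⟩, h1⟩ := hg
  exact (((act3_wBar_iff h1 _).mp hc).det_idempotent c.isUnit).1

theorem act3_wBar_of_mem {g : GL (Fin 7) R} (hg : g ∈ (Gw k).points R) :
    act3 g.1 (wBar R) = (2 * componentFun g.1 - 1) • wBar R := by
  obtain ⟨⟨c, hc⟩, h1⟩ := hg
  rw [hc, (((act3_wBar_iff h1 _).mp hc).det_idempotent c.isUnit).2]
  rfl

/-- Here `det P = det T = 1`, so the relations `det P • Q = 0` and `det T • S = 0` remove the
off-diagonal blocks, and `P Tᵀ = 1` determines `T`. -/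
theorem exists_d_eq {g : GL (Fin 7) R} (hg : g ∈ (Gw k).points R)
    (h1 : componentFun g.1 = 1) : ∃ A : SpecialLinearGroup (Fin 3) R, d A = g := by
  obtain ⟨⟨c, hc⟩, h0⟩ := hg
  have h := (act3_wBar_iff h0 _).mp hc
  have hcu := c.isUnit
  obtain ⟨hu, hv⟩ := h.vectors_eq_zero hcu
  obtain ⟨hT, hS, hPQ, hz⟩ := h.det_relations hcu
  have hP : (block11 g.1).det = 1 := h1
  have hd := h.det_sum
  have hc1 : (c : R) = 1 := by
    rw [(h.det_idempotent hcu).2, hP]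
    norm_num
  have hQ0 : block21 g.1 = 0 := by simpa [hP] using hd.det_smul_eq_zero hcu
  have hS0 : block12 g.1 = 0 := by
    simpa [hT, hP] using hd.swap_source.swap_target.det_smul_eq_zero hcu
  have hM := h.mul_transpose_sub hcu
  rw [hS0, Matrix.zero_mul, sub_zero, hc1, one_smul] at hM
  let A : SpecialLinearGroup (Fin 3) R := ⟨block11 g.1, hP⟩
  refine ⟨A, Units.ext ?_⟩
  rw [eq_block h0 hu hv, hQ0, hS0]
  change block A.1 0 0 (A⁻¹).1ᵀ = _
  congr 1
  have : (A⁻¹).1 * (A.1 * (block22 g.1)ᵀ) = (A⁻¹).1 * 1 := congrArg _ hM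
  rw [← Matrix.mul_assoc, sl_inv_mul, Matrix.one_mul, Matrix.mul_one] at this
  rw [← this, Matrix.transpose_transpose]

theorem tau_mem_Gw : tau R ∈ (Gw k).points R :=
  ⟨⟨-1, by rw [Units.val_neg, Units.val_one]; exact act3_tau_wBar⟩,
    block_mulVec_stdVec_zero _ _ _ _⟩

theorem d_injective : Function.Injective (d : SpecialLinearGroup (Fin 3) R →* GL (Fin 7) R) := by
  intro A B h
  apply Subtype.ext
  have := congrArg (fun g : GL (Fin 7) R => block11 g.1) h
  exact (block11_block _ _ _ _).symm.trans (this.trans (block11_block _ _ _ _))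

end Stabilizer

/-! ### Polynomial paths in the special linear group. -/

section Paths

open Polynomial

/-- Whitehead's identity `diag(c, c⁻¹) = w(c) w(-1)`, where `w(c)` is the product of three
transvections with parameters `c`, `-c⁻¹`, `c`. -/
theorem diag2n_eq_mul_transvection {ι K : Type*} [Fintype ι] [DecidableEq ι] [Field K] {i j : ι}
    (hij : i ≠ j) {c : K} (hc : c ≠ 0) :
    SpecialLinearGroup.diag2n hij c hc =
      SpecialLinearGroup.transvection hij c * SpecialLinearGroup.transvection hij.symm (-c⁻¹) *
      SpecialLinearGroup.transvection hij c * SpecialLinearGroup.transvection hij (-1) *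
      SpecialLinearGroup.transvection hij.symm 1 * SpecialLinearGroup.transvection hij (-1) := by
  apply SpecialLinearGroup.coeMonoidHom_injective
  have hji := hij.symm
  simp only [map_mul, SpecialLinearGroup.coeMonoidHom_apply, SpecialLinearGroup.transvection_coe,
    SpecialLinearGroup.diag2n_coe]
  have e1 : ∀ a b : K, Matrix.single i j a * Matrix.single i j b = 0 := fun a b =>
    Matrix.single_mul_single_of_ne _ _ _ _ hji _
  have e2 : ∀ a b : K, Matrix.single j i a * Matrix.single j i b = 0 := fun a b =>
    Matrix.single_mul_single_of_ne _ _ _ _ hij _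
  have e3 : ∀ a b : K, Matrix.single i i a * Matrix.single j i b = 0 := fun a b =>
    Matrix.single_mul_single_of_ne _ _ _ _ hij _
  have e4 : ∀ a b : K, Matrix.single j j a * Matrix.single i j b = 0 := fun a b =>
    Matrix.single_mul_single_of_ne _ _ _ _ hji _
  simp only [mul_add, add_mul, mul_one, one_mul, Matrix.single_mul_single_same, e1, e2, e3, e4]
  ext a b
  simp [Matrix.diagonal_apply, Matrix.single_apply, Matrix.one_apply, hc]
  grind

/-- Every matrix in `SL(n, K)` is joined to the identity by a path over `K[X]`. -/
theorem exists_polynomial_path {ι K : Type*} [Fintype ι] [DecidableEq ι] [Nontrivial ι] [Field K]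
    (A : SpecialLinearGroup ι K) : ∃ B : SpecialLinearGroup ι K[X],
      SpecialLinearGroup.map (evalRingHom 0) B = 1 ∧
      SpecialLinearGroup.map (evalRingHom 1) B = A := by
  have ht : ∀ (i j : ι) (hij : i ≠ j) (a : K), ∃ B : SpecialLinearGroup ι K[X],
      SpecialLinearGroup.map (evalRingHom 0) B = 1 ∧
      SpecialLinearGroup.map (evalRingHom 1) B = SpecialLinearGroup.transvection hij a := by
    intro i j hij a
    -- Scaling the off-diagonal entry by the parameter contracts a transvection to `1`.
    refine ⟨⟨Matrix.transvection i j (C a * X), Matrix.det_transvection_of_ne i j hij _⟩, ?_, ?_⟩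
    · refine Subtype.ext (Matrix.ext fun r s => ?_)
      change eval 0 (Matrix.transvection i j (C a * X) r s) = (1 : Matrix ι ι K) r s
      simp only [Matrix.transvection, Matrix.add_apply, Matrix.one_apply, Matrix.single_apply]
      split_ifs <;> simp
    · refine Subtype.ext (Matrix.ext fun r s => ?_)
      change eval 1 (Matrix.transvection i j (C a * X) r s) = Matrix.transvection i j a r s
      simp only [Matrix.transvection, Matrix.add_apply, Matrix.one_apply, Matrix.single_apply]
      split_ifs <;> simp
  have hm : ∀ A B : SpecialLinearGroup ι K,
      (∃ A' : SpecialLinearGroup ι K[X], SpecialLinearGroup.map (evalRingHom 0) A' = 1 ∧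
        SpecialLinearGroup.map (evalRingHom 1) A' = A) →
      (∃ B' : SpecialLinearGroup ι K[X], SpecialLinearGroup.map (evalRingHom 0) B' = 1 ∧
        SpecialLinearGroup.map (evalRingHom 1) B' = B) →
      ∃ C' : SpecialLinearGroup ι K[X], SpecialLinearGroup.map (evalRingHom 0) C' = 1 ∧
        SpecialLinearGroup.map (evalRingHom 1) C' = A * B := by
    rintro A B ⟨A', hA, hA'⟩ ⟨B', hB, hB'⟩
    exact ⟨A' * B', by rw [map_mul, hA, hB, mul_one], by rw [map_mul, hA', hB']⟩
  refine SpecialLinearGroup.diagonal_transvection_induction' _ A (fun i j hij c hc => ?_) ht hm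
  rw [diag2n_eq_mul_transvection hij hc]
  exact hm _ _ (hm _ _ (hm _ _ (hm _ _ (hm _ _ (ht _ _ _ _) (ht _ _ _ _)) (ht _ _ _ _))
    (ht _ _ _ _)) (ht _ _ _ _)) (ht _ _ _ _)

end Paths

theorem d_map {R S : Type u} [CommRing R] [CommRing S] (f : R →+* S)
    (A : SpecialLinearGroup (Fin 3) R) :
    GeneralLinearGroup.map f (d A) = d (SpecialLinearGroup.map f A) := by
  apply Units.ext
  change (block A.1 0 0 (A⁻¹).1ᵀ).map f = block (A.1.map f) 0 0 _
  rw [← map_inv]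
  simp only [block, Matrix.reindex_apply, ← Matrix.submatrix_map, Matrix.fromBlocks_map]
  simp only [Matrix.map_zero _ (map_zero f), Matrix.map_one _ (map_zero f) (map_one f)]
  rfl

/-! ### Points of the underlying space of a linear group. -/

namespace LinearGroup

variable {k : Type u} [Field k] {n : ℕ}

theorem evalAt_map {R S : Type u} [CommRing R] [Algebra k R] [CommRing S] [Algebra k S]
    (f : R →ₐ[k] S) (g : GL (Fin n) R) :
    evalAt k (GeneralLinearGroup.map (f : R →+* S) g) = f.comp (evalAt k g) := by
  apply MvPolynomial.algHom_ext
  intro ij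
  simp [evalAt]

/-- The point of `Spec k[x_ij]` below a point of `Spec R`, for an `R`-valued matrix. -/
def pointAt (k : Type u) [Field k] {n : ℕ} {R : Type u} [CommRing R] [Algebra k R]
    (g : GL (Fin n) R) (p : PrimeSpectrum R) :
    PrimeSpectrum (MvPolynomial (Fin n × Fin n) k) :=
  PrimeSpectrum.comap (evalAt k g : MvPolynomial (Fin n × Fin n) k →+* R) p

theorem pointAt_map {R S : Type u} [CommRing R] [Algebra k R] [CommRing S] [Algebra k S]
    (f : R →ₐ[k] S) (g : GL (Fin n) R) (p : PrimeSpectrum S) :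
    pointAt k (GeneralLinearGroup.map (f : R →+* S) g) p =
      pointAt k g (PrimeSpectrum.comap (f : R →+* S) p) := by
  rw [pointAt, evalAt_map]
  rfl

theorem pointAt_mem_carrier (H : LinearGroup k n) {R : Type u} [CommRing R] [Algebra k R]
    {g : GL (Fin n) R} (hg : g ∈ H.points R) (p : PrimeSpectrum R) :
    pointAt k g p ∈ H.carrier := by
  -- Base change to the residue field at `p` produces the required field-valued point.
  let f : R →ₐ[k] p.asIdeal.ResidueField := IsScalarTower.toAlgHom k R p.asIdeal.ResidueField
  refine ⟨p.asIdeal.ResidueField, inferInstance, inferInstance, _, H.map_mem f g hg, ?_⟩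
  ext x
  rw [evalAt_map, RingHom.mem_ker]
  change evalAt k g x ∈ p.asIdeal ↔ algebraMap R p.asIdeal.ResidueField (evalAt k g x) = 0
  rw [Ideal.algebraMap_residueField_eq_zero]

theorem mem_pointAt {R : Type u} [CommRing R] [Algebra k R] (g : GL (Fin n) R)
    (p : PrimeSpectrum R) (x : MvPolynomial (Fin n × Fin n) k) :
    x ∈ (pointAt k g p).asIdeal ↔ evalAt k g x ∈ p.asIdeal := Iff.rfl

theorem pointAt_one {R : Type u} [CommRing R] [Algebra k R] (p : PrimeSpectrum R) :
    pointAt k (1 : GL (Fin n) R) p = identityPoint k n := by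
  have : (1 : GL (Fin n) R) =
      GeneralLinearGroup.map ((Algebra.ofId k R : k →ₐ[k] R) : k →+* R) 1 := (map_one _).symm
  rw [this, pointAt_map]
  ext x
  rw [mem_pointAt]
  have hbot : (PrimeSpectrum.comap ((Algebra.ofId k R : k →ₐ[k] R) : k →+* R) p).asIdeal = ⊥ :=
    Ideal.eq_bot_of_prime _
  rw [hbot, Ideal.mem_bot]
  rfl

end LinearGroup

open LinearGroup

/-! ### The identity component of `G_w`. -/

section IdentityComponent

variable (k : Type u) [Field k]

/-- Over the residue field `K` at `p`, a path from `1` to the image of `A` maps the connected space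
`Spec K[X]` into `G_w`; its image contains both the identity and the given point. -/
theorem pointAt_d_mem_connectedComponentIn {R : Type u} [CommRing R] [Algebra k R]
    (A : SpecialLinearGroup (Fin 3) R) (p : PrimeSpectrum R) :
    pointAt k (d A) p ∈ connectedComponentIn (Gw k).carrier (identityPoint k 7) := by
  let K := p.asIdeal.ResidueField
  let f : R →ₐ[k] K := IsScalarTower.toAlgHom k R K
  obtain ⟨B, hB0, hB1⟩ := exists_polynomial_path (SpecialLinearGroup.map (f : R →+* K) A)
  let ev : K → Polynomial K →ₐ[k] K := fun a => (Polynomial.aeval a).restrictScalars k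
  have hev : ∀ a, ((ev a : Polynomial K →ₐ[k] K) : Polynomial K →+* K) = Polynomial.evalRingHom a :=
    fun a => RingHom.ext fun q => by simp [ev]
  let Z := Set.range (pointAt k (d B))
  have hZc : IsPreconnected Z := by
    have : PreconnectedSpace (PrimeSpectrum (Polynomial K)) := inferInstance
    exact isPreconnected_range (PrimeSpectrum.continuous_comap _)
  have hZs : Z ⊆ (Gw k).carrier := by
    rintro _ ⟨q, rfl⟩
    exact pointAt_mem_carrier _ (d_mem_Gw B) q
  have h0 : identityPoint k 7 ∈ Z := by
    refine ⟨PrimeSpectrum.comap ((ev 0 : Polynomial K →ₐ[k] K) : Polynomial K →+* K) ⊥, ?_⟩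
    rw [← pointAt_map, hev, d_map, hB0, map_one, pointAt_one]
  have h1 : pointAt k (d A) p ∈ Z := by
    refine ⟨PrimeSpectrum.comap ((ev 1 : Polynomial K →ₐ[k] K) : Polynomial K →+* K) ⊥, ?_⟩
    rw [← pointAt_map, hev, d_map, hB1, ← d_map, pointAt_map]
    congr 1
    ext x
    change algebraMap R p.asIdeal.ResidueField x ∈ (⊥ : Ideal _) ↔ _
    rw [Ideal.mem_bot, Ideal.algebraMap_residueField_eq_zero]
  exact hZc.subset_connectedComponentIn h0 hZs h1

/-- The determinant of the upper left `3 × 3` block as a polynomial in the matrix entries. -/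
def componentPoly : MvPolynomial (Fin 7 × Fin 7) k :=
  componentFun (Matrix.of fun i j => MvPolynomial.X (i, j))

theorem evalAt_componentPoly {R : Type u} [CommRing R] [Algebra k R] (g : GL (Fin 7) R) :
    evalAt k g (componentPoly k) = componentFun g.1 := by
  have := componentFun_map (evalAt k g : MvPolynomial (Fin 7 × Fin 7) k →+* R)
    (Matrix.of fun i j => MvPolynomial.X (i, j))
  refine this.symm.trans (congrArg componentFun ?_)
  ext i j
  simp [evalAt]

/-- The open sets where `componentPoly` is nonzero and where it is not `1` cover the whole spectrum,
and idempotence makes them disjoint on `G_w`. A connected set containing the identity stays in the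
first. -/
theorem connectedComponentIn_Gw_subset :
    connectedComponentIn (Gw k).carrier (identityPoint k 7) ⊆
      PrimeSpectrum.basicOpen (componentPoly k) := by
  have hid : identityPoint k 7 ∈ (Gw k).carrier := by
    rw [← pointAt_one (k := k) (R := k) ⊥]
    exact pointAt_mem_carrier _ (one_mem _) _
  let U : Set (PrimeSpectrum (MvPolynomial (Fin 7 × Fin 7) k)) :=
    PrimeSpectrum.basicOpen (componentPoly k)
  let V : Set (PrimeSpectrum (MvPolynomial (Fin 7 × Fin 7) k)) :=
    PrimeSpectrum.basicOpen (componentPoly k - 1)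
  have hcar : ∀ q ∈ (Gw k).carrier,
      componentPoly k ∈ q.asIdeal ∨ componentPoly k - 1 ∈ q.asIdeal := by
    rintro q ⟨K, _, _, g, hg, hq⟩
    rw [hq, RingHom.mem_ker, RingHom.mem_ker, map_sub, map_one, evalAt_componentPoly, sub_eq_zero]
    exact IsIdempotentElem.iff_eq_zero_or_one.mp (isIdempotentElem_componentFun hg)
  intro q hq
  by_contra hqU
  have hsub : connectedComponentIn (Gw k).carrier (identityPoint k 7) ⊆ U ∪ V := by
    intro r _
    by_contra hr
    simp only [U, V, Set.mem_union, SetLike.mem_coe, PrimeSpectrum.mem_basicOpen, not_or,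
      not_not] at hr
    apply r.2.ne_top
    rw [Ideal.eq_top_iff_one]
    have := r.asIdeal.sub_mem hr.1 hr.2
    rwa [sub_sub_cancel] at this
  have hone : identityPoint k 7 ∈ U := by
    rw [← pointAt_one (k := k) (R := k) ⊥]
    change ¬ evalAt k (1 : GL (Fin 7) k) (componentPoly k) ∈ (⊥ : PrimeSpectrum k).asIdeal
    rw [evalAt_componentPoly, ← map_one d, componentFun_d]
    exact fun h => (⊥ : PrimeSpectrum k).2.ne_top ((Ideal.eq_top_iff_one _).mpr h)
  obtain ⟨r, hr, hrU, hrV⟩ := isPreconnected_connectedComponentIn U V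
    (PrimeSpectrum.basicOpen _).isOpen (PrimeSpectrum.basicOpen _).isOpen hsub
    ⟨_, mem_connectedComponentIn hid, hone⟩ ⟨q, hq, (hsub hq).resolve_left hqU⟩
  exact (hcar r (connectedComponentIn_subset _ _ hr)).elim hrU hrV

theorem identityComponent_Gw (R : Type u) [CommRing R] [Algebra k R] :
    (Gw k).identityComponent R =
      Set.range (d : SpecialLinearGroup (Fin 3) R →* GL (Fin 7) R) := by
  ext g
  constructor
  · rintro ⟨hg, hp⟩
    -- The value lies in no maximal ideal, so it is a unit; an idempotent unit is `1`.
    have hu : IsUnit (componentFun g.1) := by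
      by_contra hnu
      obtain ⟨M, hM, hmem⟩ := exists_max_ideal_of_mem_nonunits hnu
      have := connectedComponentIn_Gw_subset k (hp ⟨M, hM.isPrime⟩)
      apply this
      change evalAt k g (componentPoly k) ∈ M
      rwa [evalAt_componentPoly]
    exact exists_d_eq hg ((IsIdempotentElem.iff_eq_one_of_isUnit hu).mp (isIdempotentElem_componentFun hg))
  · rintro ⟨A, rfl⟩
    exact ⟨d_mem_Gw A, fun p => pointAt_d_mem_connectedComponentIn k A p⟩

end IdentityComponent

/-! ### Sections of the constant group `ℤ/2` as idempotents. -/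

section ConstantGroup

variable {R : Type u} [CommRing R]

/-- The section of the constant group scheme `ℤ/2` that is trivial exactly where the idempotent `e`
does not vanish. -/
def constOf (e : R) (he : IsIdempotentElem e) : ConstZ2 R where
  toFun := open Classical in fun p => if e ∈ p.asIdeal then Multiplicative.ofAdd 1 else 1
  isLocallyConstant := by
    classical
    refine (IsLocallyConstant.iff_continuous _).mpr ?_
    refine continuous_if (fun p hp => ?_) continuousOn_const continuousOn_const
    have hcl : IsClopen {p : PrimeSpectrum R | e ∈ p.asIdeal} := by
      refine PrimeSpectrum.isClopen_iff_zeroLocus.mpr ⟨e, he, ?_⟩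
      ext p
      simp [PrimeSpectrum.mem_zeroLocus]
    rw [hcl.frontier_eq] at hp
    exact hp.elim

theorem multiplicative_zmod_two_eq_iff {x y : Multiplicative (ZMod 2)} :
    x = y ↔ (x = 1 ↔ y = 1) := by
  revert x y
  decide

theorem constOf_apply_eq_one_iff {e : R} (he : IsIdempotentElem e) (p : PrimeSpectrum R) :
    constOf e he p = 1 ↔ p ∈ PrimeSpectrum.basicOpen e := by
  classical
  change (if e ∈ p.asIdeal then Multiplicative.ofAdd 1 else 1) = (1 : Multiplicative (ZMod 2)) ↔ _
  rw [PrimeSpectrum.mem_basicOpen]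
  split_ifs with h
  · simp only [h, not_true_eq_false, iff_false]
    decide
  · simp [h]

theorem constZ2_ext {x y : ConstZ2 R} (h : ∀ p, x p = 1 ↔ y p = 1) : x = y :=
  LocallyConstant.ext fun p => multiplicative_zmod_two_eq_iff.mpr (h p)

theorem constOf_congr {e e' : R} (h : e = e') (he : IsIdempotentElem e)
    (he' : IsIdempotentElem e') : constOf e he = constOf e' he' := by
  subst h
  rfl

theorem constOf_injective {e e' : R} {he : IsIdempotentElem e} {he' : IsIdempotentElem e'}
    (h : constOf e he = constOf e' he') : e = e' := by
  refine PrimeSpectrum.basicOpen_injOn_isIdempotentElem he he' ?_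
  ext p
  change p ∈ PrimeSpectrum.basicOpen e ↔ p ∈ PrimeSpectrum.basicOpen e'
  rw [← constOf_apply_eq_one_iff he, h, constOf_apply_eq_one_iff he']

theorem exists_constOf_eq (x : ConstZ2 R) : ∃ e : {e : R // IsIdempotentElem e},
    constOf e.1 e.2 = x := by
  obtain ⟨e, he, hs⟩ := PrimeSpectrum.exists_idempotent_basicOpen_eq_of_isClopen
    (x.isLocallyConstant.isClopen_fiber 1)
  refine ⟨⟨e, he⟩, constZ2_ext fun p => ?_⟩
  rw [constOf_apply_eq_one_iff]
  exact (Set.ext_iff.mp hs p).symm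

/-- The idempotent which is `1` where a section of `ℤ/2` is trivial and `0` elsewhere. -/
def idemOf (x : ConstZ2 R) : R := (exists_constOf_eq x).choose.1

theorem isIdempotentElem_idemOf (x : ConstZ2 R) : IsIdempotentElem (idemOf x) :=
  (exists_constOf_eq x).choose.2

theorem constOf_idemOf (x : ConstZ2 R) : constOf (idemOf x) (isIdempotentElem_idemOf x) = x :=
  (exists_constOf_eq x).choose_spec

theorem idemOf_constOf {e : R} (he : IsIdempotentElem e) : idemOf (constOf e he) = e :=
  constOf_injective (constOf_idemOf _)

theorem isIdempotentElem_xnor {a b : R} (ha : IsIdempotentElem a) (hb : IsIdempotentElem b) :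
    IsIdempotentElem (a * b + (1 - a) * (1 - b)) := by
  have ha' : a * a = a := ha
  have hb' : b * b = b := hb
  change (a * b + (1 - a) * (1 - b)) * (a * b + (1 - a) * (1 - b)) = _
  linear_combination (4 * b * b - 4 * b + 1) * ha' + hb'

/-- The value `1` of the idempotent marks the trivial element, and a product in `ℤ/2` is trivial
exactly where the factors agree. Modulo each prime both idempotents are `0` or `1`. -/
theorem constOf_xnor {a b : R} (ha : IsIdempotentElem a) (hb : IsIdempotentElem b) :
    constOf (a * b + (1 - a) * (1 - b)) (isIdempotentElem_xnor ha hb) =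
      constOf a ha * constOf b hb := by
  apply constZ2_ext
  intro p
  have hmul : ∀ x y : Multiplicative (ZMod 2), x * y = 1 ↔ (x = 1 ↔ y = 1) := by decide
  rw [LocallyConstant.mul_apply, hmul, constOf_apply_eq_one_iff, constOf_apply_eq_one_iff,
    constOf_apply_eq_one_iff, PrimeSpectrum.mem_basicOpen, PrimeSpectrum.mem_basicOpen,
    PrimeSpectrum.mem_basicOpen]
  let q := Ideal.Quotient.mk p.asIdeal
  have hq : ∀ x, x ∈ p.asIdeal ↔ q x = 0 := fun x => Ideal.Quotient.eq_zero_iff_mem.symm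
  simp only [hq, map_add, map_mul, map_sub, map_one]
  have ha' := IsIdempotentElem.iff_eq_zero_or_one.mp (ha.map q)
  have hb' := IsIdempotentElem.iff_eq_zero_or_one.mp (hb.map q)
  rcases ha' with h | h <;> rcases hb' with h' | h' <;> simp [h, h']

theorem idemOf_mul (x y : ConstZ2 R) :
    idemOf (x * y) = idemOf x * idemOf y + (1 - idemOf x) * (1 - idemOf y) := by
  conv_lhs => rw [← constOf_idemOf x, ← constOf_idemOf y, ← constOf_xnor, idemOf_constOf]

theorem constOf_one : constOf (1 : R) IsIdempotentElem.one = 1 := by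
  apply constZ2_ext
  intro p
  rw [constOf_apply_eq_one_iff]
  simp

theorem constOf_zero : constOf (0 : R) IsIdempotentElem.zero = ConstZ2.gen R := by
  apply constZ2_ext
  intro p
  rw [constOf_apply_eq_one_iff]
  have : ConstZ2.gen R p ≠ 1 := by
    change Multiplicative.ofAdd (1 : ZMod 2) ≠ 1
    decide
  simp [this]

theorem map_constOf {S : Type u} [CommRing S] (f : R →+* S) {e : R} (he : IsIdempotentElem e) :
    ConstZ2.map f (constOf e he) = constOf (f e) (he.map f) :=
  rfl

theorem idemOf_map {S : Type u} [CommRing S] (f : R →+* S) (x : ConstZ2 R) :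
    idemOf (ConstZ2.map f x) = f (idemOf x) := by
  conv_lhs => rw [← constOf_idemOf x, map_constOf, idemOf_constOf]

end ConstantGroup

/-! ### The component homomorphism and its splitting. -/

section Splitting

variable {R : Type u} [CommRing R]

theorem tau_mul_tau : (tau R).1 * (tau R).1 = 1 := (tau R).val_inv

theorem glue_mul_glue (a b : R) :
    (a • (1 : Matrix (Fin 7) (Fin 7) R) + (1 - a) • (tau R).1) * (b • 1 + (1 - b) • (tau R).1) =
      (a * b + (1 - a) * (1 - b)) • 1 +
        (1 - (a * b + (1 - a) * (1 - b))) • (tau R).1 := by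
  simp only [add_mul, mul_add, Matrix.smul_mul, Matrix.mul_smul, Matrix.one_mul, Matrix.mul_one,
    tau_mul_tau]
  module

theorem glue_mul_self {e : R} (he : IsIdempotentElem e) :
    (e • (1 : Matrix (Fin 7) (Fin 7) R) + (1 - e) • (tau R).1) * (e • 1 + (1 - e) • (tau R).1) =
      1 := by
  have he' : e * e + (1 - e) * (1 - e) = 1 := by
    have : e * e = e := he
    linear_combination 2 * this
  rw [glue_mul_glue, he', one_smul, sub_self, zero_smul, add_zero]

/-- The element of `GL(7)` equal to `1` where the idempotent `e` is `1` and to `τ` elsewhere. -/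
def glue (e : R) (he : IsIdempotentElem e) : GL (Fin 7) R where
  val := e • 1 + (1 - e) • (tau R).1
  inv := e • 1 + (1 - e) • (tau R).1
  val_inv := glue_mul_self he
  inv_val := glue_mul_self he

theorem glue_zero : glue (0 : R) IsIdempotentElem.zero = tau R := by
  apply Units.ext
  simp [glue]

theorem glue_congr {e e' : R} (h : e = e') (he : IsIdempotentElem e) (he' : IsIdempotentElem e') :
    glue e he = glue e' he' := by
  subst h
  rfl

/-- Since `e ^ 3 = e`, the scalar can be moved into all three factors of a wedge. This permits
computing with a glued matrix separately on the parts `e` and `1 - e`. -/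
theorem smul_act3_congr {e : R} (he : IsIdempotentElem e) {g h : Matrix (Fin 7) (Fin 7) R}
    (hgh : e • g = e • h) : e • act3 g = e • act3 h := by
  have key : ∀ (g : Matrix (Fin 7) (Fin 7) R) (v : Fin 3 → Fin 7 → R),
      e • act3 g (exteriorPower.ιMulti R 3 v) =
        exteriorPower.ιMulti R 3 fun i => (e • g) *ᵥ v i := by
    intro g v
    have := (exteriorPower.ιMulti R 3).map_smul_univ (fun _ : Fin 3 => e) fun i => g *ᵥ v i
    rw [Finset.prod_const, Finset.card_univ, Fintype.card_fin, he.pow_eq three_ne_zero] at this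
    rw [act3, exteriorPower.map_apply_ιMulti]
    simp only [Matrix.smul_mulVec]
    exact this.symm
  apply exteriorPower.linearMap_ext
  ext1 v
  exact (key g v).trans ((congrArg (fun m : Matrix (Fin 7) (Fin 7) R =>
    exteriorPower.ιMulti R 3 fun i => m *ᵥ v i) hgh).trans (key h v).symm)

theorem act3_glue_wBar {e : R} (he : IsIdempotentElem e) :
    act3 (glue e he).1 (wBar R) = (2 * e - 1) • wBar R := by
  have hee : e * e = e := he
  have h1 : e • (glue e he).1 = e • (1 : Matrix (Fin 7) (Fin 7) R) := by
    change e • (e • 1 + (1 - e) • (tau R).1) = _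
    have h0 : e * (1 - e) = 0 := by linear_combination -hee
    rw [smul_add, smul_smul, smul_smul, hee, h0, zero_smul, add_zero]
  have h2 : (1 - e) • (glue e he).1 = (1 - e) • (tau R).1 := by
    change (1 - e) • (e • 1 + (1 - e) • (tau R).1) = _
    have h0 : (1 - e) * e = 0 := by linear_combination -hee
    have h0' : (1 - e) * (1 - e) = 1 - e := he.one_sub
    rw [smul_add, smul_smul, smul_smul, h0', h0, zero_smul, zero_add]
  have h3 := LinearMap.congr_fun (smul_act3_congr he h1) (wBar R)
  have h4 := LinearMap.congr_fun (smul_act3_congr he.one_sub h2) (wBar R)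
  rw [LinearMap.smul_apply, LinearMap.smul_apply, act3_one, LinearMap.id_apply] at h3
  rw [LinearMap.smul_apply, LinearMap.smul_apply, act3_tau_wBar] at h4
  calc act3 (glue e he).1 (wBar R)
      = e • act3 (glue e he).1 (wBar R) + (1 - e) • act3 (glue e he).1 (wBar R) := by module
    _ = _ := by rw [h3, h4]; module

theorem componentFun_glue {e : R} (he : IsIdempotentElem e) :
    componentFun (glue e he).1 = e := by
  have h : block11 (glue e he).1 = e • 1 := by
    have h1 : block11 (tau R).1 = 0 := block11_block _ _ _ _
    have h2 : block11 (1 : Matrix (Fin 7) (Fin 7) R) = 1 := by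
      rw [← block_one, block11_block]
    change e • block11 1 + (1 - e) • block11 (tau R).1 = _
    rw [h1, h2, smul_zero, add_zero]
  rw [componentFun, h, Matrix.det_smul, Matrix.det_one, Fintype.card_fin, mul_one,
    he.pow_eq three_ne_zero]

theorem tau_map {S : Type u} [CommRing S] (f : R →+* S) : (tau R).1.map f = (tau S).1 := by
  have hL : (Lam R).map f = Lam S := by
    rw [Lam, Lam, Matrix.diagonal_map (map_zero f)]
    congr 1
    funext i
    fin_cases i <;> simp
  change (block 0 (Lam R) (Lam R) 0).map f = block 0 (Lam S) (Lam S) 0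
  simp only [block, Matrix.reindex_apply, ← Matrix.submatrix_map, Matrix.fromBlocks_map, hL]
  simp only [Matrix.map_zero _ (map_zero f), Matrix.map_one _ (map_zero f) (map_one f)]

theorem glue_map {S : Type u} [CommRing S] (f : R →+* S) {e : R} (he : IsIdempotentElem e) :
    GeneralLinearGroup.map f (glue e he) = glue (f e) (he.map f) := by
  apply Units.ext
  change (e • (1 : Matrix (Fin 7) (Fin 7) R) + (1 - e) • (tau R).1).map f =
    f e • 1 + (1 - f e) • (tau S).1
  rw [← tau_map f]
  ext i j
  simp [Matrix.one_apply, apply_ite f]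

variable {k : Type u} [Field k] [Algebra k R]

theorem glue_mem_Gw {e : R} (he : IsIdempotentElem e) : glue e he ∈ (Gw k).points R := by
  have hu : (2 * e - 1) * (2 * e - 1) = 1 := by
    have : e * e = e := he
    linear_combination 4 * this
  refine ⟨⟨⟨2 * e - 1, 2 * e - 1, hu, hu⟩, act3_glue_wBar he⟩, ?_⟩
  change (e • (1 : Matrix (Fin 7) (Fin 7) R) + (1 - e) • (tau R).1) *ᵥ stdVec R 0 = _
  rw [Matrix.add_mulVec, Matrix.smul_mulVec, Matrix.smul_mulVec, Matrix.one_mulVec,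
    show (tau R).1 *ᵥ stdVec R 0 = stdVec R 0 from block_mulVec_stdVec_zero _ _ _ _]
  module

theorem isUnit_two [CharZero k] : IsUnit (2 : R) := by
  have : IsUnit (algebraMap k R 2) := (isUnit_iff_ne_zero.mpr two_ne_zero).map _
  rwa [map_ofNat] at this

/-- The multiplier `2e - 1` is multiplicative; solving for `e` requires dividing by `2`. -/
theorem componentFun_mul [CharZero k] {g h : GL (Fin 7) R} (hg : g ∈ (Gw k).points R)
    (hh : h ∈ (Gw k).points R) : componentFun (g * h).1 = componentFun g.1 * componentFun h.1 +
      (1 - componentFun g.1) * (1 - componentFun h.1) := by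
  have h1 := act3_wBar_of_mem (mul_mem hg hh)
  rw [Units.val_mul, act3_mul, LinearMap.comp_apply, act3_wBar_of_mem hh, map_smul,
    act3_wBar_of_mem hg, smul_smul] at h1
  have h2 := smul_wBar_injective h1
  rw [← Units.val_mul] at h2
  apply (isUnit_two (k := k) (R := R)).mul_left_cancel
  linear_combination -h2

variable (R k)

/-- The homomorphism `G_w → ℤ/2` onto the group of components. -/
def componentHom [CharZero k] : (Gw k).points R →* ConstZ2 R :=
  MonoidHom.mk' (fun g => constOf (componentFun g.1.1) (isIdempotentElem_componentFun g.2))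
    fun g h => by
      rw [← constOf_xnor]
      congr 1
      exact componentFun_mul g.2 h.2

/-- The homomorphism `ℤ/2 → G_w` that sends the nontrivial element to `τ`. -/
def splitting : ConstZ2 R →* (Gw k).points R :=
  MonoidHom.mk' (fun x => ⟨glue (idemOf x) (isIdempotentElem_idemOf x), glue_mem_Gw _⟩)
    fun x y => by
      apply Subtype.ext
      apply Units.ext
      change _ = (_ : Matrix (Fin 7) (Fin 7) R) * _
      refine Eq.trans ?_ (glue_mul_glue (idemOf x) (idemOf y)).symm
      rw [← idemOf_mul]
      rfl

variable {R k}

theorem componentHom_apply [CharZero k] (g : (Gw k).points R) :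
    componentHom R k g = constOf (componentFun g.1.1) (isIdempotentElem_componentFun g.2) :=
  rfl

theorem coe_splitting_apply (x : ConstZ2 R) :
    (splitting R k x : GL (Fin 7) R) = glue (idemOf x) (isIdempotentElem_idemOf x) :=
  rfl

theorem componentHom_eq_one_iff [CharZero k] (g : (Gw k).points R) :
    componentHom R k g = 1 ↔ componentFun g.1.1 = 1 := by
  rw [← constOf_one, componentHom_apply]
  exact ⟨fun h => constOf_injective h, fun h => constOf_congr h _ _⟩

theorem map_ker_componentHom [CharZero k] :
    (componentHom R k).ker.map ((Gw k).points R).subtype =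
      (d : SpecialLinearGroup (Fin 3) R →* GL (Fin 7) R).range := by
  ext g
  constructor
  · rintro ⟨g, hg, rfl⟩
    exact exists_d_eq g.2 ((componentHom_eq_one_iff g).mp hg)
  · rintro ⟨A, rfl⟩
    exact ⟨⟨d A, d_mem_Gw A⟩, (componentHom_eq_one_iff _).mpr (componentFun_d A), rfl⟩

theorem componentHom_comp_splitting [CharZero k] :
    (componentHom R k).comp (splitting R k) = MonoidHom.id (ConstZ2 R) := by
  ext1 x
  refine Eq.trans ?_ (constOf_idemOf x)
  rw [MonoidHom.comp_apply, componentHom_apply]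
  exact constOf_congr (componentFun_glue (isIdempotentElem_idemOf x)) _ _

theorem splitting_gen : (splitting R k (ConstZ2.gen R) : GL (Fin 7) R) = tau R := by
  rw [coe_splitting_apply, ← glue_zero]
  exact glue_congr (by rw [← constOf_zero, idemOf_constOf]) _ _

theorem componentHom_map [CharZero k] {S : Type u} [CommRing S] [Algebra k S] (f : R →ₐ[k] S)
    (g : (Gw k).points R) :
    componentHom S k ((Gw k).map f g) = ConstZ2.map (f : R →+* S) (componentHom R k g) := by
  rw [componentHom_apply, componentHom_apply, map_constOf]
  exact constOf_congr (componentFun_map (f : R →+* S) g.1.1) _ _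

theorem splitting_map {S : Type u} [CommRing S] [Algebra k S] (f : R →ₐ[k] S)
    (x : ConstZ2 R) :
    splitting S k (ConstZ2.map (f : R →+* S) x) = (Gw k).map f (splitting R k x) := by
  apply Subtype.ext
  refine Eq.trans ?_ (glue_map (f : R →+* S) (isIdempotentElem_idemOf x)).symm
  rw [coe_splitting_apply]
  exact glue_congr (idemOf_map _ x) _ _

theorem orderOf_tau [Nontrivial R] : orderOf (tau R) = 2 := by
  refine orderOf_eq_prime ?_ fun h => ?_
  · rw [pow_two]
    exact Units.ext tau_mul_tau
  · have h1 := componentFun_tau (R := R)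
    rw [h, ← map_one d, componentFun_d] at h1
    exact one_ne_zero h1

theorem eq_zero_or_one_of_connectedSpace [ConnectedSpace (PrimeSpectrum R)] {e : R}
    (he : IsIdempotentElem e) : e = 0 ∨ e = 1 := by
  have hcl : IsClopen (PrimeSpectrum.basicOpen e : Set (PrimeSpectrum R)) :=
    PrimeSpectrum.isClopen_iff.mpr ⟨e, he, rfl⟩
  rcases isClopen_iff.mp hcl with h | h
  · left
    refine PrimeSpectrum.basicOpen_injOn_isIdempotentElem he IsIdempotentElem.zero ?_
    apply SetLike.coe_injective
    simpa using h
  · right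
    refine PrimeSpectrum.basicOpen_injOn_isIdempotentElem he IsIdempotentElem.one ?_
    apply SetLike.coe_injective
    simpa using h

theorem points_Gw_eq_closure [CharZero k] [ConnectedSpace (PrimeSpectrum R)] :
    (Gw k).points R = Subgroup.closure ((Gw k).identityComponent R ∪ {tau R}) := by
  apply le_antisymm
  · intro g hg
    have hd : ∀ A, d A ∈ Subgroup.closure ((Gw k).identityComponent R ∪ {tau R}) := fun A =>
      Subgroup.subset_closure (Or.inl (by rw [identityComponent_Gw]; exact ⟨A, rfl⟩))
    have ht : tau R ∈ Subgroup.closure ((Gw k).identityComponent R ∪ {tau R}) :=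
      Subgroup.subset_closure (Or.inr rfl)
    rcases eq_zero_or_one_of_connectedSpace (isIdempotentElem_componentFun hg) with h | h
    -- An element off the identity component is moved into it by `τ`.
    · have h1 : componentFun (g * tau R).1 = 1 := by
        rw [componentFun_mul hg tau_mem_Gw, h, componentFun_tau]
        ring
      obtain ⟨A, hA⟩ := exists_d_eq (mul_mem hg tau_mem_Gw) h1
      rw [← mul_inv_cancel_right g (tau R), ← hA]
      exact mul_mem (hd A) (inv_mem ht)
    · obtain ⟨A, rfl⟩ := exists_d_eq hg h
      exact hd A
  · rw [Subgroup.closure_le]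
    rintro g (hg | rfl)
    · exact hg.1
    · exact tau_mem_Gw

end Splitting

end PrehomG2

end

open PrehomG2 Matrix in
theorem mainTheorem2 (k : Type u) [Field k] [CharZero k] :
    -- `d` is an isomorphism of group functors from `SL(3)` onto the identity component of `G_w`
    ((∀ (R S : Type u) [CommRing R] [Algebra k R] [CommRing S] [Algebra k S] (f : R →ₐ[k] S)
        (A : SpecialLinearGroup (Fin 3) R),
        GeneralLinearGroup.map (f : R →+* S) (d A) =
          d (SpecialLinearGroup.map (f : R →+* S) A)) ∧
      (∀ (R : Type u) [CommRing R] [Algebra k R],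
        Function.Injective (d : SpecialLinearGroup (Fin 3) R →* GL (Fin 7) R) ∧
        (Gw k).identityComponent R =
          Set.range (d : SpecialLinearGroup (Fin 3) R →* GL (Fin 7) R))) ∧
    -- `G_w` is generated by its identity component and the involution `τ`
    (∀ (R : Type u) [CommRing R] [Algebra k R] [ConnectedSpace (PrimeSpectrum R)],
      orderOf (tau R) = 2 ∧
      (Gw k).points R = Subgroup.closure ((Gw k).identityComponent R ∪ {tau R})) ∧
    -- the split exact sequence `1 → SL(3) → G_w → ℤ/2 → 1`
    (∃ (π : ∀ (R : Type u) [CommRing R] [Algebra k R], (Gw k).points R →* ConstZ2 R)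
       (s : ∀ (R : Type u) [CommRing R] [Algebra k R], ConstZ2 R →* (Gw k).points R),
      (∀ (R S : Type u) [CommRing R] [Algebra k R] [CommRing S] [Algebra k S] (f : R →ₐ[k] S),
        (∀ g, π S ((Gw k).map f g) = ConstZ2.map (f : R →+* S) (π R g)) ∧
        (∀ e, s S (ConstZ2.map (f : R →+* S) e) = (Gw k).map f (s R e))) ∧
      (∀ (R : Type u) [CommRing R] [Algebra k R],
        (π R).comp (s R) = MonoidHom.id (ConstZ2 R) ∧
        ((s R (ConstZ2.gen R) : (Gw k).points R) : GL (Fin 7) R) = tau R ∧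
        (π R).ker.map ((Gw k).points R).subtype =
          (d : SpecialLinearGroup (Fin 3) R →* GL (Fin 7) R).range)) := by
  refine ⟨⟨fun R S _ _ _ _ f A => d_map (f : R →+* S) A,
    fun R _ _ => ⟨d_injective, identityComponent_Gw k R⟩⟩, fun R _ _ hR => ?_,
    fun R _ _ => componentHom R k, fun R _ _ => splitting R k,
    fun R S _ _ _ _ f => ⟨componentHom_map f, splitting_map f⟩,
    fun R _ _ => ⟨componentHom_comp_splitting, splitting_gen, map_ker_componentHom⟩⟩
  have : Nontrivial R := PrimeSpectrum.nonempty_iff_nontrivial.mp hR.toNonempty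
  exact ⟨orderOf_tau, points_Gw_eq_closure⟩
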